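/- Let $(X_j)_{j\ge 0}$ be i.i.d. real random variables on a probability space with mean zero and variance one. For $n\ge 1$ let $RC_n$ be the $n\times n$ reverse circulant matrix with entries $X_j/\sqrt n$, that is, the real symmetric matrix whose $(i,j)$ entry ($1\le i,j\le n$) is $X_r/\sqrt n$, where $r\in\{1,\dots,n\}$ is the index with $r\equiv i+j-1 \pmod n$. Let $F_{RC_n}=\frac1n\sum_{k=1}^n\delta_{\lambda_k}$ be its empirical spectral distribution, where $\lambda_1,\dots,\lambda_n$ are the eigenvalues of $RC_n$ counted with multiplicity. Then, almost surely, $F_{RC_n}$ converges weakly, as $n\to\infty$, to the symmetrized Rayleigh distribution, which is the probability measure on $\mathbb R$ with density $|x|e^{-x^2}$, $x\in\mathbb R$. Moreover, for every integer $p\ge 0$ the $2p$-th moment of this limit distribution is $p!$. -/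

import Mathlib

open MeasureTheory ProbabilityTheory Filter Topology

/-- The `n × n` reverse circulant matrix with first row `x 1, x 2, …, x n`: each row is the
previous one shifted circularly to the left by one position. With rows and columns numbered
from `1`, the `(i, j)` entry is `x r` with `r ∈ {1, …, n}` and `r ≡ i + j - 1` modulo `n`;
`Fin n` numbers them from `0`, which gives `r = (i + j) % n + 1`. -/
def revCirculant (n : ℕ) (x : ℕ → ℝ) : Matrix (Fin n) (Fin n) ℝ :=
  Matrix.of fun i j => x (((i : ℕ) + (j : ℕ)) % n + 1)

theorem revCirculant_isHermitian (n : ℕ) (x : ℕ → ℝ) : (revCirculant n x).IsHermitian := by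
  ext i j
  simp [revCirculant, Matrix.conjTranspose_apply, add_comm]

/-- The empirical spectral distribution of a real symmetric matrix: the probability measure on
`ℝ` that puts mass `1 / n` at each of the `n` eigenvalues, counted with multiplicity. -/
noncomputable def esd {ι : Type*} [Fintype ι] [DecidableEq ι] [Nonempty ι]
    (A : Matrix ι ι ℝ) (hA : A.IsHermitian) : ProbabilityMeasure ℝ :=
  ⟨(Fintype.card ι : ENNReal)⁻¹ • ∑ k, Measure.dirac (hA.eigenvalues k), ⟨by
    simp only [Measure.smul_apply, Measure.finsetSum_apply, measure_univ, Finset.sum_const,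
      Finset.card_univ, nsmul_eq_mul, mul_one, smul_eq_mul]
    exact ENNReal.inv_mul_cancel (by simp) (by simp)⟩⟩

theorem lintegral_abs_mul_exp_neg_sq :
    ∫⁻ x : ℝ, ENNReal.ofReal (|x| * Real.exp (-x ^ 2)) = 1 := by
  have hi : Integrable fun x : ℝ => |x| * Real.exp (-x ^ 2) := by
    have h := (integrable_mul_exp_neg_mul_sq (b := 1) one_pos).norm
    simpa [abs_mul, Real.abs_exp] using h
  rw [← ofReal_integral_eq_lintegral_ofReal hi (ae_of_all _ fun x => by positivity)]
  have h1 : ∫ x : ℝ, |x| * Real.exp (-x ^ 2) = 1 := by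
    have h2 := integral_comp_abs (f := fun x : ℝ => x * Real.exp (-x ^ 2))
    simp only [sq_abs] at h2
    have h3 := integral_rpow_mul_exp_neg_rpow (p := 2) (q := 1) (by norm_num) (by norm_num)
    norm_num at h3
    rw [h2, h3]
    norm_num
  rw [h1, ENNReal.ofReal_one]

/-- The symmetrized Rayleigh distribution: the probability measure on `ℝ` with density
`|x| * exp (-x ^ 2)` with respect to Lebesgue measure. -/
noncomputable def symRayleigh : ProbabilityMeasure ℝ :=
  ⟨(volume : Measure ℝ).withDensity fun x => ENNReal.ofReal (|x| * Real.exp (-x ^ 2)),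
    ⟨by rw [withDensity_apply _ MeasurableSet.univ, Measure.restrict_univ,
      lintegral_abs_mul_exp_neg_sq]⟩⟩

/-! The matrix with entries `x (i + j)` on `ZMod N` sends the character of frequency `k` to the
Fourier coefficient of `x` at `k` times the character of frequency `-k`. On a pair `{k, -k}` its
eigenvalues are therefore plus and minus the modulus of the coefficient; at most two frequencies
satisfy `k = -k`, and they carry weight `O(1/N)`. Up to that error, the spectral distribution tests
`f` as the empirical measure of the normalized Fourier coefficients in `ℂ` tests the symmetrization
`(f ‖z‖ + f (-‖z‖)) / 2` (`sum_eigenvalues_comp`, `integral_esd_revCirculant`).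

It remains to show that this planar empirical measure converges almost surely to the standard
complex Gaussian, since in polar coordinates the symmetrized modulus of that Gaussian is symmetrized
Rayleigh (`integral_complexGaussian_symmetrized_norm`). This is done with characteristic functions.
Their means converge by a Lindeberg-type comparison (`tendsto_integral_empiricalCharFun`). Their
fluctuations are controlled for truncated entries: Efron–Stein applied twice bounds the fourth
central moment by `O(1/N²)`, which is summable. Truncation is removed with only a second moment,
because the empirical characteristic function is Lipschitz for the root mean square norm, with a
constant free of `N`, and the strong law controls the truncated part. -/

/-- The discrete Fourier coefficient `∑ j, x j ω ^ (j k)` with `ω = exp (2 π i / N)`. -/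
noncomputable def fourierCoeffZMod {N : ℕ} [NeZero N] (x : ZMod N → ℝ) (k : ZMod N) : ℂ :=
  ∑ j, (x j : ℂ) * ZMod.stdAddChar (j * k)

/-! ### Spectrum of the reverse circulant through the finite Fourier transform. -/

section Fourier

variable {N : ℕ} [NeZero N]

theorem sum_stdAddChar_mul (k : ZMod N) :
    ∑ j : ZMod N, ZMod.stdAddChar (j * k) = if k = 0 then (N : ℂ) else 0 := by
  have := AddChar.sum_mulShift k (ZMod.isPrimitive_stdAddChar N)
  rw [this]; simp [ZMod.card]

theorem conj_stdAddChar (j : ZMod N) :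
    (starRingEnd ℂ) (ZMod.stdAddChar j) = ZMod.stdAddChar (-j) := by
  rw [AddChar.map_neg_eq_conj]

theorem fourierCoeffZMod_neg (x : ZMod N → ℝ) (k : ZMod N) :
    fourierCoeffZMod x (-k) = (starRingEnd ℂ) (fourierCoeffZMod x k) := by
  simp [fourierCoeffZMod, map_sum, conj_stdAddChar, mul_neg]

/-- The matrix of the reverse circulant matrix in the Fourier basis. -/
noncomputable def fourierBlock (x : ZMod N → ℝ) : Matrix (ZMod N) (ZMod N) ℂ :=
  Matrix.of fun l k => if l = -k then fourierCoeffZMod x k else 0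

/-- Frequency `k` goes to `-k` and back, collecting the product of the coefficients at `k` and `-k`;
these are conjugate because `x` is real. -/
theorem fourierBlock_sq (x : ZMod N → ℝ) :
    fourierBlock x ^ 2 = Matrix.diagonal fun k => ((‖fourierCoeffZMod x k‖ : ℂ)) ^ 2 := by
  ext l k
  rw [pow_two, Matrix.mul_apply]
  simp only [fourierBlock, Matrix.of_apply]
  rw [Finset.sum_eq_single (-k)]
  · by_cases h : l = k
    · subst h
      simp [fourierCoeffZMod_neg, Complex.conj_mul']
    · simp [h]
  · intro b _ hb
    simp [hb]
  · simp

theorem trace_fourierBlock_pow_even (x : ZMod N → ℝ) (m : ℕ) :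
    (fourierBlock x ^ (2 * m)).trace = ∑ k, (‖fourierCoeffZMod x k‖ : ℂ) ^ (2 * m) := by
  rw [pow_mul, fourierBlock_sq, Matrix.diagonal_pow, Matrix.trace_diagonal]
  simp [pow_mul]

theorem fourierCoeffZMod_eq_re {x : ZMod N → ℝ} {k : ZMod N} (hk : k = -k) :
    fourierCoeffZMod x k = ((fourierCoeffZMod x k).re : ℂ) := by
  have h := fourierCoeffZMod_neg x k
  rw [← hk] at h
  exact (Complex.conj_eq_iff_re.mp h.symm).symm

/-- An odd power still exchanges `k` and `-k`, so only frequencies fixed by negation reach the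
diagonal; there the coefficient is real. -/
theorem trace_fourierBlock_pow_odd (x : ZMod N → ℝ) (m : ℕ) :
    (fourierBlock x ^ (2 * m + 1)).trace =
      ∑ k with k = -k, ((fourierCoeffZMod x k).re : ℂ) ^ (2 * m + 1) := by
  rw [pow_succ, pow_mul, fourierBlock_sq, Matrix.diagonal_pow, Matrix.trace, Finset.sum_filter]
  refine Finset.sum_congr rfl fun k _ => ?_
  rw [Matrix.diag_apply, Matrix.diagonal_mul]
  simp only [fourierBlock, Matrix.of_apply, Pi.pow_apply]
  split_ifs with h
  · rw [fourierCoeffZMod_eq_re h, Complex.norm_real, Real.norm_eq_abs, Complex.ofReal_re,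
      ← Complex.ofReal_pow, sq_abs]
    push_cast
    ring
  · simp

/-- The Fourier matrix. -/
noncomputable def fourierMatrix (N : ℕ) [NeZero N] : Matrix (ZMod N) (ZMod N) ℂ :=
  Matrix.of fun j k => ZMod.stdAddChar (j * k)

theorem fourierMatrix_mul_conj :
    fourierMatrix N * ((N : ℂ)⁻¹ • Matrix.of fun j k => ZMod.stdAddChar (-(j * k))) = 1 := by
  ext i k
  have hN : (N : ℂ) ≠ 0 := by exact_mod_cast NeZero.ne N
  rw [Matrix.mul_smul, Matrix.smul_apply, Matrix.mul_apply]
  simp only [fourierMatrix, Matrix.of_apply, ← AddChar.map_add_eq_mul]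
  have : ∀ j : ZMod N, i * j + -(j * k) = j * (i - k) := fun j => by ring
  simp only [this, sum_stdAddChar_mul, sub_eq_zero, Matrix.one_apply]
  split_ifs <;> simp [hN]

/-- Translating the summation index by `i` pulls out the character value at `-(i * k)`, which is the
entry of the column of frequency `-k`. -/
theorem mul_fourierMatrix (x : ZMod N → ℝ) :
    (Matrix.of fun i j : ZMod N => (x (i + j) : ℂ)) * fourierMatrix N =
      fourierMatrix N * fourierBlock x := by
  ext i k
  simp only [Matrix.mul_apply, fourierMatrix, fourierBlock, Matrix.of_apply]
  simp only [mul_ite, mul_zero, Finset.sum_ite_eq', Finset.mem_univ, if_true, fourierCoeffZMod]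
  rw [Finset.mul_sum, ← Equiv.sum_comp (Equiv.addLeft i)
    fun j => ZMod.stdAddChar (i * -k) * ((x j : ℂ) * ZMod.stdAddChar (j * k))]
  refine Finset.sum_congr rfl fun j _ => ?_
  simp only [Equiv.coe_addLeft]
  rw [mul_left_comm, ← AddChar.map_add_eq_mul]
  congr 2
  ring

theorem trace_pow_of_add (x : ZMod N → ℝ) (m : ℕ) :
    ((Matrix.of fun i j : ZMod N => (x (i + j) : ℂ)) ^ m).trace = (fourierBlock x ^ m).trace := by
  set G : Matrix (ZMod N) (ZMod N) ℂ :=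
    (N : ℂ)⁻¹ • Matrix.of fun j k => ZMod.stdAddChar (-(j * k))
  have h1 : fourierMatrix N * G = 1 := fourierMatrix_mul_conj
  have h3 : ∀ m : ℕ, (Matrix.of fun i j : ZMod N => (x (i + j) : ℂ)) ^ m * fourierMatrix N =
      fourierMatrix N * fourierBlock x ^ m := by
    intro m
    induction m with
    | zero => simp
    | succ m ih => rw [pow_succ, Matrix.mul_assoc, mul_fourierMatrix, ← Matrix.mul_assoc, ih,
        Matrix.mul_assoc, ← pow_succ]
  calc _ = ((Matrix.of fun i j : ZMod N => (x (i + j) : ℂ)) ^ m * fourierMatrix N * G).trace := by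
        rw [Matrix.mul_assoc, h1, Matrix.mul_one]
    _ = _ := by
        rw [h3, Matrix.mul_assoc, Matrix.trace_mul_comm, Matrix.mul_assoc,
          mul_eq_one_comm.mp h1, Matrix.mul_one]

theorem Matrix.IsHermitian.trace_pow_eq_sum {ι : Type*} [Fintype ι] [DecidableEq ι]
    {A : Matrix ι ι ℝ} (hA : A.IsHermitian) (m : ℕ) :
    (A ^ m).trace = ∑ k, hA.eigenvalues k ^ m := by
  conv_lhs => rw [hA.spectral_theorem, ← map_pow, Unitary.conjStarAlgAut_apply,
    Matrix.trace_mul_comm, ← mul_assoc, Unitary.coe_star_mul_self, one_mul, Matrix.diagonal_pow,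
    Matrix.trace_diagonal]
  simp

/-- One formula for both parities of `m`: the first sum keeps even powers only, the second odd
powers only. -/
theorem sum_eigenvalues_pow {x : ZMod N → ℝ}
    (hA : (Matrix.of fun i j : ZMod N => x (i + j)).IsHermitian) (m : ℕ) :
    ∑ k, hA.eigenvalues k ^ m =
      ∑ k, (‖fourierCoeffZMod x k‖ ^ m + (-‖fourierCoeffZMod x k‖) ^ m) / 2 +
      ∑ k with k = -k, ((fourierCoeffZMod x k).re ^ m - (-(fourierCoeffZMod x k).re) ^ m) / 2 := by
  rw [← hA.trace_pow_eq_sum]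
  apply Complex.ofReal_injective
  have h : ((((Matrix.of fun i j : ZMod N => x (i + j)) ^ m).trace : ℝ) : ℂ) =
      ((Matrix.of fun i j : ZMod N => (x (i + j) : ℂ)) ^ m).trace := by
    have : (Matrix.of fun i j : ZMod N => (x (i + j) : ℂ)) =
      (Complex.ofRealHom).mapMatrix (Matrix.of fun i j : ZMod N => x (i + j)) := by
        ext; simp
    rw [this, ← map_pow Complex.ofRealHom.mapMatrix]
    simp [Matrix.trace]
  rw [h, trace_pow_of_add]
  rcases Nat.even_or_odd' m with ⟨l, rfl | rfl⟩
  · rw [trace_fourierBlock_pow_even]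
    push_cast
    simp [pow_mul]
  · rw [trace_fourierBlock_pow_odd]
    push_cast
    simp [Odd.neg_pow (⟨l, rfl⟩ : Odd (2 * l + 1))]

/-- The identity is linear in `f` and known for monomials, hence for polynomials. Only finitely many
points occur, so `f` may be replaced by its Lagrange interpolant there; no explicit list of
eigenvalues is needed. -/
theorem sum_eigenvalues_comp {x : ZMod N → ℝ}
    (hA : (Matrix.of fun i j : ZMod N => x (i + j)).IsHermitian) (f : ℝ → ℝ) :
    ∑ k, f (hA.eigenvalues k) =
      ∑ k, (f ‖fourierCoeffZMod x k‖ + f (-‖fourierCoeffZMod x k‖)) / 2 +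
      ∑ k with k = -k, (f (fourierCoeffZMod x k).re - f (-(fourierCoeffZMod x k).re)) / 2 := by
  classical
  have hp : ∀ p : Polynomial ℝ, ∑ k, p.eval (hA.eigenvalues k) =
      ∑ k, (p.eval ‖fourierCoeffZMod x k‖ + p.eval (-‖fourierCoeffZMod x k‖)) / 2 +
      ∑ k with k = -k,
        (p.eval (fourierCoeffZMod x k).re - p.eval (-(fourierCoeffZMod x k).re)) / 2 := by
    intro p
    induction p using Polynomial.induction_on' with
    | add p q hp hq =>
      simp only [Polynomial.eval_add, Finset.sum_add_distrib, hp, hq, ← Finset.sum_div,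
        Finset.sum_sub_distrib]
      ring
    | monomial m a =>
      simp only [Polynomial.eval_monomial, ← Finset.mul_sum, sum_eigenvalues_pow hA,
        ← mul_add, ← mul_sub, mul_div_assoc]
  let S : Finset ℝ := Finset.univ.image hA.eigenvalues ∪
    (Finset.univ.image (fun k => ‖fourierCoeffZMod x k‖) ∪
    (Finset.univ.image (fun k => -‖fourierCoeffZMod x k‖) ∪
    (Finset.univ.image (fun k => (fourierCoeffZMod x k).re) ∪
      Finset.univ.image (fun k => -(fourierCoeffZMod x k).re))))
  have hS : ∀ r ∈ S, (Lagrange.interpolate S id f).eval r = f r := fun r hr =>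
    Lagrange.eval_interpolate_at_node (v := id) f (Function.injective_id.injOn) hr
  have := hp (Lagrange.interpolate S id f)
  convert this using 1
  · exact Finset.sum_congr rfl fun k _ => (hS _ (by simp [S])).symm
  · congr 1
    · exact Finset.sum_congr rfl fun k _ => by rw [hS _ (by simp [S]), hS _ (by simp [S])]
    · exact Finset.sum_congr rfl fun k _ => by rw [hS _ (by simp [S]), hS _ (by simp [S])]

/-- The only candidates are `0` and, for even `N`, `N / 2`. This makes the exceptional frequencies
negligible after division by `N`. -/
theorem card_eq_neg_le_two : (Finset.univ.filter fun k : ZMod N => k = -k).card ≤ 2 := by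
  have h : ∀ k : ZMod N, k = -k → k.val = 0 ∨ 2 * k.val = N := by
    intro k hk
    by_cases h0 : k = 0
    · left; simp [h0]
    · right
      have : NeZero k := ⟨h0⟩
      have := ZMod.val_neg_of_ne_zero k
      rw [← hk] at this
      have := ZMod.val_lt k
      omega
  calc (Finset.univ.filter fun k : ZMod N => k = -k).card
      = ((Finset.univ.filter fun k : ZMod N => k = -k).image ZMod.val).card :=
        (Finset.card_image_of_injective _ (ZMod.val_injective N)).symm
    _ ≤ ({0, N / 2} : Finset ℕ).card := by
        refine Finset.card_le_card fun m hm => ?_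
        simp only [Finset.mem_image, Finset.mem_filter, Finset.mem_univ, true_and] at hm
        obtain ⟨k, hk, rfl⟩ := hm
        rcases h k hk with h | h
        · simp [h]
        · simp only [Finset.mem_insert, Finset.mem_singleton]; right; omega
    _ ≤ 2 := Finset.card_le_two

/-! ### Orthogonality estimates for the projected Fourier basis. -/

/-- The coordinates in direction `t` of the normalized Fourier basis. -/
noncomputable def fourierWeight (t : ℂ) (k j : ZMod N) : ℝ :=
  inner ℝ (ZMod.stdAddChar (j * k) : ℂ) t / Real.sqrt N

theorem norm_stdAddChar (j : ZMod N) : ‖(ZMod.stdAddChar j : ℂ)‖ = 1 := AddChar.norm_apply _ _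

theorem abs_fourierWeight_le (t : ℂ) (k j : ZMod N) :
    |fourierWeight t k j| ≤ ‖t‖ / Real.sqrt N := by
  rw [fourierWeight, abs_div, abs_of_nonneg (Real.sqrt_nonneg _)]
  gcongr
  simpa [norm_stdAddChar] using abs_real_inner_le_norm (ZMod.stdAddChar (j * k) : ℂ) t

theorem fourierWeight_comm (t : ℂ) (k j : ZMod N) : fourierWeight t k j = fourierWeight t j k := by
  rw [fourierWeight, fourierWeight, mul_comm]

theorem fourierWeight_sub (t s : ℂ) (k j : ZMod N) :
    fourierWeight (t - s) k j = fourierWeight t k j - fourierWeight s k j := by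
  rw [fourierWeight, inner_sub_right, sub_div]; rfl

/-- For `‖z‖ = 1` the squared inner product with `t` is `‖t‖ ^ 2 / 2` plus half the real part of
`conj t ^ 2 * z ^ 2`. The second term has frequency `2 * k ≠ 0` and sums to zero. The value `1 / 2`
is the variance per direction that makes the limit Gaussian isotropic. -/
theorem sum_fourierWeight_sq (t : ℂ) {k : ZMod N} (hk : k ≠ -k) :
    ∑ j, fourierWeight t k j ^ 2 = ‖t‖ ^ 2 / 2 := by
  have hN : (0 : ℝ) < N := by exact_mod_cast NeZero.pos N
  have h : ∀ j : ZMod N, (fourierWeight t k j) ^ 2 =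
      (‖t‖ ^ 2 / 2 + (((starRingEnd ℂ) t) ^ 2 * ZMod.stdAddChar (j * (2 * k))).re / 2) / N := by
    intro j
    rw [fourierWeight, div_pow, Real.sq_sqrt hN.le]
    congr 1
    have h1 : (ZMod.stdAddChar (j * (2 * k)) : ℂ) = ZMod.stdAddChar (j * k) ^ 2 := by
      rw [← AddChar.map_nsmul_eq_pow]; congr 1; simp; ring
    have h2 := norm_stdAddChar (j * k)
    rw [h1]
    generalize (ZMod.stdAddChar (j * k) : ℂ) = z at *
    have h3 : z.re ^ 2 + z.im ^ 2 = 1 := by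
      have := Complex.sq_norm z; rw [h2, Complex.normSq_apply] at this; linarith
    rw [Complex.inner, Complex.sq_norm, Complex.normSq_apply]
    simp [pow_two]
    have : z.im ^ 2 = 1 - z.re ^ 2 := by linarith
    ring_nf
    rw [this]; ring
  simp_rw [h]
  rw [← Finset.sum_div, Finset.sum_add_distrib, ← Finset.sum_div _ _ (2 : ℝ),
    ← Finset.sum_div _ _ (2 : ℝ), ← Complex.re_sum,
    ← Finset.mul_sum, sum_stdAddChar_mul]
  have : 2 * k ≠ 0 := fun h => hk (by rw [eq_neg_iff_add_eq_zero, ← two_mul, h])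
  simp [this, ZMod.card]
  field_simp

theorem sum_norm_sq_sum_stdAddChar (u : ZMod N → ℂ) :
    ∑ j : ZMod N, ‖∑ k, ZMod.stdAddChar (j * k) * u k‖ ^ 2 = N * ∑ k, ‖u k‖ ^ 2 := by
  apply Complex.ofReal_injective
  push_cast
  simp_rw [← Complex.mul_conj', map_sum, Finset.sum_mul_sum, map_mul, conj_stdAddChar]
  rw [Finset.sum_comm, Finset.mul_sum]
  refine Finset.sum_congr rfl fun k _ => ?_
  rw [Finset.sum_comm, Finset.sum_eq_single k]
  · have : ∀ i : ZMod N, ZMod.stdAddChar (i * k) * u k *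
        (ZMod.stdAddChar (-(i * k)) * (starRingEnd ℂ) (u k)) = u k * (starRingEnd ℂ) (u k) := by
      intro i
      have : ZMod.stdAddChar (i * k) * ZMod.stdAddChar (-(i * k)) = (1 : ℂ) := by
        rw [← AddChar.map_add_eq_mul]; simp
      linear_combination (u k * (starRingEnd ℂ) (u k)) * this
    simp [this, ZMod.card]
  · intro l _ hl
    have : ∀ i : ZMod N, ZMod.stdAddChar (i * k) * u k *
        (ZMod.stdAddChar (-(i * l)) * (starRingEnd ℂ) (u l)) =
        ZMod.stdAddChar (i * (k - l)) * (u k * (starRingEnd ℂ) (u l)) := by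
      intro i
      have : ZMod.stdAddChar (i * (k - l)) =
          ZMod.stdAddChar (i * k) * (ZMod.stdAddChar (-(i * l)) : ℂ) := by
        rw [← AddChar.map_add_eq_mul]; congr 1; ring
      rw [this]; ring
    simp only [this, ← Finset.sum_mul, sum_stdAddChar_mul, sub_eq_zero, Ne.symm hl, if_false,
      zero_mul]
  · simp

/-- Each weight combines the frequencies `k` and `-k`, and Parseval applies to both. This bound,
uniform in `N`, gives both the Lipschitz estimates and the total influence bound. -/
theorem sum_norm_sq_sum_fourierWeight_le (t : ℂ) (u : ZMod N → ℂ) :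
    ∑ j, ‖∑ k, (fourierWeight t k j : ℂ) * u k‖ ^ 2 ≤ ‖t‖ ^ 2 * ∑ k, ‖u k‖ ^ 2 := by
  have hN : (0 : ℝ) < N := by exact_mod_cast NeZero.pos N
  have hw : ∀ k j : ZMod N, (fourierWeight t k j : ℂ) =
      ((starRingEnd ℂ) t * ZMod.stdAddChar (j * k) + t * ZMod.stdAddChar (j * -k)) /
        (2 * Real.sqrt N) := by
    intro k j
    have : (inner ℝ (ZMod.stdAddChar (j * k) : ℂ) t : ℂ) =
        ((starRingEnd ℂ) t * ZMod.stdAddChar (j * k) + t * ZMod.stdAddChar (j * -k)) / 2 := by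
      rw [Complex.inner, Complex.re_eq_add_conj, mul_neg, ← conj_stdAddChar, RingHom.map_mul,
        Complex.conj_conj]
      ring
    rw [fourierWeight, Complex.ofReal_div, this, div_div]
  have hb : ∀ j, ‖∑ k, (fourierWeight t k j : ℂ) * u k‖ ^ 2 ≤ ‖t‖ ^ 2 / (2 * N) *
      (‖∑ k, ZMod.stdAddChar (j * k) * u k‖ ^ 2 + ‖∑ k, ZMod.stdAddChar (j * k) * u (-k)‖ ^ 2) := by
    intro j
    have h1 : ∑ k, (fourierWeight t k j : ℂ) * u k =
        ((starRingEnd ℂ) t * ∑ k, ZMod.stdAddChar (j * k) * u k +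
          t * ∑ k, ZMod.stdAddChar (j * k) * u (-k)) / (2 * Real.sqrt N) := by
      rw [← Equiv.sum_comp (Equiv.neg (ZMod N)) fun k => ZMod.stdAddChar (j * k) * u (-k)]
      simp_rw [hw, Finset.mul_sum, ← Finset.sum_add_distrib, Finset.sum_div]
      refine Finset.sum_congr rfl fun k _ => ?_
      simp only [Equiv.neg_apply, neg_neg]
      ring
    rw [h1]
    generalize ∑ k, ZMod.stdAddChar (j * k) * u k = a
    generalize ∑ k, ZMod.stdAddChar (j * k) * u (-k) = b
    rw [norm_div, div_pow]
    have h2 : ‖(2 * (Real.sqrt N : ℂ))‖ ^ 2 = 4 * N := by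
      rw [norm_mul, mul_pow, Complex.norm_real, Real.norm_eq_abs, sq_abs, Real.sq_sqrt hN.le]
      norm_num
    have h3 : ‖(starRingEnd ℂ) t * a + t * b‖ ≤ ‖t‖ * (‖a‖ + ‖b‖) := by
      refine (norm_add_le _ _).trans (le_of_eq ?_)
      rw [norm_mul, norm_mul, RCLike.norm_conj]; ring
    have h4 : ‖(starRingEnd ℂ) t * a + t * b‖ ^ 2 ≤ ‖t‖ ^ 2 * (2 * (‖a‖ ^ 2 + ‖b‖ ^ 2)) := by
      refine (pow_le_pow_left₀ (norm_nonneg _) h3 2).trans ?_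
      rw [mul_pow]
      gcongr
      nlinarith [sq_nonneg (‖a‖ - ‖b‖)]
    rw [h2, div_le_iff₀ (by positivity)]
    refine h4.trans (le_of_eq ?_)
    field_simp
    ring
  refine (Finset.sum_le_sum fun j _ => hb j).trans (le_of_eq ?_)
  rw [← Finset.mul_sum, Finset.sum_add_distrib, sum_norm_sq_sum_stdAddChar,
    sum_norm_sq_sum_stdAddChar, ← Equiv.sum_comp (Equiv.neg (ZMod N)) fun k => ‖u k‖ ^ 2]
  simp only [Equiv.neg_apply]
  field_simp
  ring

theorem inner_fourierCoeffZMod (t : ℂ) (x : ZMod N → ℝ) (k : ZMod N) :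
    inner ℝ (fourierCoeffZMod (fun j => x j / Real.sqrt N) k) t =
      ∑ j, fourierWeight t k j * x j := by
  rw [fourierCoeffZMod, sum_inner]
  refine Finset.sum_congr rfl fun j _ => ?_
  rw [← Complex.real_smul, real_inner_smul_left, fourierWeight]
  ring

end Fourier

/-! ### Efron–Stein inequality and a fourth moment bound. -/

section EfronStein

theorem sq_integral_le_integral_sq {α : Type*} [MeasurableSpace α] {μ : Measure α}
    [IsProbabilityMeasure μ] {f : α → ℝ} (hf : MemLp f 2 μ) :
    (∫ x, f x ∂μ) ^ 2 ≤ ∫ x, f x ^ 2 ∂μ := by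
  have h := variance_eq_sub hf
  have h' := variance_nonneg f μ
  simp only [Pi.pow_apply] at h
  linarith

theorem integrable_of_measurable_of_abs_le {α : Type*} [MeasurableSpace α] {μ : Measure α}
    [IsFiniteMeasure μ] {f : α → ℝ} (hf : Measurable f) {c : ℝ} (hc : ∀ x, |f x| ≤ c) :
    Integrable f μ :=
  Integrable.of_bound hf.aestronglyMeasurable c (ae_of_all _ hc)

theorem memLp_two_of_measurable_of_abs_le {α : Type*} [MeasurableSpace α] {μ : Measure α}
    [IsFiniteMeasure μ] {f : α → ℝ} (hf : Measurable f) {c : ℝ} (hc : ∀ x, |f x| ≤ c) :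
    MemLp f 2 μ :=
  MemLp.of_bound hf.aestronglyMeasurable c (ae_of_all _ hc)

theorem abs_integral_le_of_abs_le {α : Type*} [MeasurableSpace α] {μ : Measure α}
    [IsProbabilityMeasure μ] {f : α → ℝ} {c : ℝ} (hc : ∀ x, |f x| ≤ c) :
    |∫ x, f x ∂μ| ≤ c := by
  have := norm_integral_le_of_norm_le_const (f := f) (μ := μ) (C := c) (ae_of_all _ hc)
  simpa using this

/-- The variance is half the mean square difference of two independent copies. -/
theorem variance_le_half_integral {α : Type*} [MeasurableSpace α] {μ : Measure α}
    [IsProbabilityMeasure μ] {f B : α → ℝ} (hf : Measurable f) (hB : Measurable B) {c : ℝ}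
    (hc : ∀ x, |f x| ≤ c) (hcB : ∀ x, |B x| ≤ c) (h : ∀ x y, (f x - f y) ^ 2 ≤ B x) :
    ∫ x, f x ^ 2 ∂μ - (∫ x, f x ∂μ) ^ 2 ≤ (∫ x, B x ∂μ) / 2 := by
  have hi := integrable_of_measurable_of_abs_le (μ := μ) hf hc
  have hi2 := (memLp_two_of_measurable_of_abs_le (μ := μ) hf hc).integrable_sq
  have h1 : ∀ x, ∫ y, (f x - f y) ^ 2 ∂μ =
      f x ^ 2 - 2 * f x * (∫ y, f y ∂μ) + ∫ y, f y ^ 2 ∂μ := by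
    intro x
    simp_rw [sub_sq]
    rw [integral_add (f := fun y => f x ^ 2 - 2 * f x * f y)
        ((integrable_const _).sub (hi.const_mul _)) hi2,
      integral_sub (integrable_const _) (hi.const_mul _), integral_const_mul]
    simp
  have h2 : ∫ x, ∫ y, (f x - f y) ^ 2 ∂μ ∂μ =
      2 * (∫ x, f x ^ 2 ∂μ - (∫ x, f x ∂μ) ^ 2) := by
    simp_rw [h1]
    rw [integral_add (f := fun x => f x ^ 2 - 2 * f x * ∫ y, f y ∂μ)
        (hi2.sub ((hi.const_mul 2).mul_const _)) (integrable_const _),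
      integral_sub hi2 ((hi.const_mul 2).mul_const _), integral_mul_const, integral_const_mul]
    simp
    ring
  have h3 : ∫ x, ∫ y, (f x - f y) ^ 2 ∂μ ∂μ ≤ ∫ x, B x ∂μ := by
    refine integral_mono_of_nonneg (ae_of_all _ fun x => integral_nonneg fun y => sq_nonneg _)
      (integrable_of_measurable_of_abs_le hB hcB) (ae_of_all _ fun x => ?_)
    calc ∫ y, (f x - f y) ^ 2 ∂μ ≤ ∫ _, B x ∂μ :=
          integral_mono_of_nonneg (ae_of_all _ fun y => sq_nonneg _) (integrable_const _)
            (ae_of_all _ fun y => h x y)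
      _ = B x := by simp
  linarith

/-- The Efron–Stein inequality. -/
theorem variance_pi_le_half_integral_sum {α : Type*} [MeasurableSpace α] (μ : Measure α)
    [IsProbabilityMeasure μ] (n : ℕ) (f : (Fin n → α) → ℝ) (B : Fin n → (Fin n → α) → ℝ)
    (hf : Measurable f) (hB : ∀ j, Measurable (B j)) (c : ℝ) (hc : ∀ x, |f x| ≤ c)
    (hcB : ∀ j x, |B j x| ≤ c)
    (h : ∀ j x y, (f x - f (Function.update x j y)) ^ 2 ≤ B j x) :
    ∫ x, f x ^ 2 ∂(Measure.pi fun _ => μ) - (∫ x, f x ∂(Measure.pi fun _ => μ)) ^ 2 ≤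
      (∑ j, ∫ x, B j x ∂(Measure.pi fun _ => μ)) / 2 := by
  induction n with
  | zero =>
    have : f = fun _ => f default := funext fun x => by rw [Subsingleton.elim x default]
    rw [this]
    simp
  | succ n ih =>
    have hmp := (measurePreserving_piFinSuccAbove (fun _ : Fin (n + 1) => μ) 0).symm
    -- The bound `c ^ 2 + |c|` covers `f`, `f ^ 2` and every `B j` at once.
    have hcomp : ∀ g : (Fin (n + 1) → α) → ℝ, Measurable g → (∀ x, |g x| ≤ c ^ 2 + |c|) →
        ∫ x, g x ∂(Measure.pi fun _ => μ) =
          ∫ x, ∫ y, g (Fin.cons y x) ∂μ ∂(Measure.pi fun _ : Fin n => μ) := by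
      intro g hg hgc
      rw [← hmp.integral_comp', integral_prod_symm]
      · simp [MeasurableEquiv.piFinSuccAbove_symm_apply, Fin.insertNthEquiv]
      · exact integrable_of_measurable_of_abs_le (hg.comp (MeasurableEquiv.measurable _))
          (fun x => hgc _)
    have hcons : Measurable fun p : (Fin n → α) × α => (Fin.cons p.2 p.1 : Fin (n + 1) → α) := by
      rw [measurable_pi_iff]
      intro i
      refine Fin.cases ?_ (fun i => ?_) i
      · simpa using measurable_snd
      · exact (measurable_pi_apply i).comp measurable_fst
    have hcons1 : ∀ x : Fin n → α,
        Measurable fun y : α => (Fin.cons y x : Fin (n + 1) → α) :=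
      fun x => hcons.comp (measurable_const.prodMk measurable_id)
    have hint : ∀ g : (Fin (n + 1) → α) → ℝ, Measurable g →
        Measurable fun x : Fin n → α => ∫ y, g (Fin.cons y x) ∂μ := fun g hg =>
      (StronglyMeasurable.integral_prod_right (f := fun x y => g (Fin.cons y x)) (ν := μ)
        (hg.comp hcons).stronglyMeasurable).measurable
    have hf2 : ∀ x, |f x ^ 2| ≤ c ^ 2 := fun x => by
      rw [abs_pow]; exact pow_le_pow_left₀ (abs_nonneg _) (hc x) 2
    have hle : ∀ a, |a| ≤ c → |a| ≤ c ^ 2 + |c| := fun a ha => by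
      nlinarith [sq_nonneg c, le_abs_self c]
    rw [hcomp _ (hf.pow_const 2) fun x => (hf2 x).trans (by simp),
      hcomp _ hf fun x => hle _ (hc x)]
    simp_rw [fun j => hcomp _ (hB j) fun x => hle _ (hcB j x)]
    have hg := hint f hf
    have hgc : ∀ x : Fin n → α, |∫ y, f (Fin.cons y x) ∂μ| ≤ c :=
      fun x => abs_integral_le_of_abs_le fun y => hc _
    -- Variance is the variance of the conditional mean plus the mean of the conditional variance.
    -- The conditional mean over coordinate `0` goes to the induction hypothesis; Jensen bounds its
    -- squared jumps by the averaged `B j.succ`.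
    have h1 := ih (fun x => ∫ y, f (Fin.cons y x) ∂μ)
      (fun j x => ∫ y, B j.succ (Fin.cons y x) ∂μ) hg
      (fun j => hint _ (hB j.succ)) hgc
      (fun j x => abs_integral_le_of_abs_le fun y => hcB _ _) (by
        intro j x y
        rw [← integral_sub]
        · refine (sq_integral_le_integral_sq (memLp_two_of_measurable_of_abs_le (c := c + c)
            ((hf.comp (hcons1 _)).sub (hf.comp (hcons1 _))) fun z => ?_)).trans ?_
          · exact (abs_sub _ _).trans (add_le_add (hc _) (hc _))
          · refine integral_mono_of_nonneg (ae_of_all _ fun z => sq_nonneg _)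
              (integrable_of_measurable_of_abs_le ((hB _).comp (hcons1 _)) fun z => hcB _ _)
              (ae_of_all _ fun z => ?_)
            have := h j.succ (Fin.cons z x) y
            rwa [← Fin.cons_update] at this
        · exact integrable_of_measurable_of_abs_le (hf.comp (hcons1 _)) fun z => hc _
        · exact integrable_of_measurable_of_abs_le (hf.comp (hcons1 _)) fun z => hc _)
    -- The conditional variance involves coordinate `0` alone, so the one-variable bound applies on
    -- each fibre.
    have h2 : ∫ x, ((∫ y, f (Fin.cons y x) ^ 2 ∂μ) - (∫ y, f (Fin.cons y x) ∂μ) ^ 2)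
          ∂(Measure.pi fun _ : Fin n => μ) ≤
        ∫ x, (∫ y, B 0 (Fin.cons y x) ∂μ) / 2 ∂(Measure.pi fun _ : Fin n => μ) := by
      have hi1 : Integrable (fun x : Fin n → α => ∫ y, f (Fin.cons y x) ^ 2 ∂μ)
          (Measure.pi fun _ => μ) :=
        integrable_of_measurable_of_abs_le (hint _ (hf.pow_const 2))
          fun x => abs_integral_le_of_abs_le fun y => hf2 _
      refine integral_mono (hi1.sub (memLp_two_of_measurable_of_abs_le hg hgc).integrable_sq)
        ((integrable_of_measurable_of_abs_le (hint _ (hB 0))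
          fun x => abs_integral_le_of_abs_le fun y => hcB _ _).div_const 2) fun x => ?_
      refine variance_le_half_integral (hf.comp (hcons1 x)) ((hB 0).comp (hcons1 x))
        (fun y => hc _) (fun y => hcB _ _) fun y z => ?_
      have := h 0 (Fin.cons y x) z
      rwa [Fin.update_cons_zero] at this
    rw [integral_sub, integral_div] at h2
    · rw [Fin.sum_univ_succ]
      linarith
    · exact integrable_of_measurable_of_abs_le (hint _ (hf.pow_const 2))
          fun x => abs_integral_le_of_abs_le fun y => hf2 _
    · exact (memLp_two_of_measurable_of_abs_le hg hgc).integrable_sq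

/-- The fourth central moment is the variance of `(f - m) ^ 2` plus the square of the variance of
`f`. Efron–Stein bounds the latter by `(C / 2) ^ 2` and, applied to `(f - m) ^ 2`, the former by `3
* C ^ 2`. With `C` of order `1 / N` this is summable, whereas the variance bound alone is not. -/
theorem integral_sub_integral_pow_four_le {α : Type*} [MeasurableSpace α] (μ : Measure α)
    [IsProbabilityMeasure μ] (n : ℕ) (f : (Fin n → α) → ℝ) (B : Fin n → (Fin n → α) → ℝ)
    (hf : Measurable f) (hB : ∀ j, Measurable (B j)) {c : ℝ} (hc : ∀ x, |f x| ≤ c)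
    {C : ℝ} (hB0 : ∀ j x, 0 ≤ B j x) (hC : ∀ x, ∑ j, B j x ≤ C)
    (h : ∀ j x y, (f x - f (Function.update x j y)) ^ 2 ≤ B j x) :
    ∫ x, (f x - ∫ y, f y ∂(Measure.pi fun _ => μ)) ^ 4 ∂(Measure.pi fun _ => μ) ≤ 4 * C ^ 2 := by
  set π := Measure.pi fun _ : Fin n => μ with hπ
  set m := ∫ y, f y ∂π with hm
  have hBC : ∀ j x, B j x ≤ C := fun j x =>
    (Finset.single_le_sum (f := fun j => B j x) (fun i _ => hB0 i x) (Finset.mem_univ j)).trans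
      (hC x)
  have hBC' : ∀ j x, |B j x| ≤ C := fun j x => by rw [abs_of_nonneg (hB0 j x)]; exact hBC j x
  have hn : Nonempty (Fin n → α) := by
    obtain ⟨a⟩ := μ.nonempty_of_neZero
    exact ⟨fun _ => a⟩
  have hC0 : 0 ≤ C := (Finset.sum_nonneg fun j _ => hB0 j hn.some).trans (hC _)
  have hc0 : 0 ≤ c := (abs_nonneg _).trans (hc hn.some)
  have hsum : ∀ {D : Fin n → (Fin n → α) → ℝ}, (∀ j, Measurable (D j)) → (c' : ℝ) →
      (∀ j x, |D j x| ≤ c') → ∑ j, ∫ x, D j x ∂π = ∫ x, ∑ j, D j x ∂π := fun hD c' hc' =>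
    (integral_finsetSum _ fun j _ => integrable_of_measurable_of_abs_le (hD j) (hc' j)).symm
  have hmc : |m| ≤ c := abs_integral_le_of_abs_le hc
  have hgm : Measurable fun x => f x - m := hf.sub_const m
  have hgc : ∀ x, |f x - m| ≤ 2 * c := fun x => (abs_sub _ _).trans (by linarith [hc x])
  have hg2c : ∀ x, (f x - m) ^ 2 ≤ (2 * c) ^ 2 := fun x => by
    rw [← sq_abs]; exact pow_le_pow_left₀ (abs_nonneg _) (hgc x) 2
  have hi2 : Integrable (fun x => (f x - m) ^ 2) π :=
    (memLp_two_of_measurable_of_abs_le hgm hgc).integrable_sq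
  have hvar : ∫ x, (f x - m) ^ 2 ∂π ≤ C / 2 := by
    have h1 := variance_pi_le_half_integral_sum μ n (fun x => f x - m) B hgm hB (2 * c + C)
      (fun x => (hgc x).trans (by linarith)) (fun j x => (hBC' j x).trans (by linarith))
      (fun j x y => by simpa using h j x y)
    rw [← hπ, hsum hB C hBC'] at h1
    have h0 : ∫ x, (f x - m) ∂π = 0 := by
      rw [integral_sub (integrable_of_measurable_of_abs_le hf hc) (integrable_const _)]
      simp [hm]
    rw [h0] at h1
    have h2 : ∫ x, ∑ j, B j x ∂π ≤ ∫ _, C ∂π :=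
      integral_mono (integrable_finsetSum _ fun j _ =>
        integrable_of_measurable_of_abs_le (hB j) (hBC' j)) (integrable_const _) hC
    simp at h2
    linarith
  -- With `a = f x - m` and `d` the jump of `f`, the jump of the square is `d * (2 * a - d)`; its
  -- square is at most `d ^ 2 * (8 * a ^ 2 + 2 * d ^ 2)`, and `d ^ 2 ≤ B j x`.
  let D : Fin n → (Fin n → α) → ℝ := fun j x => 8 * (f x - m) ^ 2 * B j x + 2 * B j x ^ 2
  have hD : ∀ j, Measurable (D j) := fun j =>
    (((hgm.pow_const 2).const_mul 8).mul (hB j)).add (((hB j).pow_const 2).const_mul 2)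
  set c' : ℝ := 8 * (2 * c) ^ 2 * C + 2 * C ^ 2 with hc'
  have hDc : ∀ j x, |D j x| ≤ c' := by
    intro j x
    have := hB0 j x
    rw [abs_of_nonneg (by positivity)]
    have := hg2c x
    have := hBC j x
    simp only [D, hc']
    gcongr
  have hvar2 := variance_pi_le_half_integral_sum μ n (fun x => (f x - m) ^ 2) D
    (hgm.pow_const 2) hD ((2 * c) ^ 2 + c')
    (fun x => by
      rw [abs_of_nonneg (sq_nonneg _)]
      have : 0 ≤ c' := by positivity
      linarith [hg2c x])
    (fun j x => (hDc j x).trans (by simp; positivity))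
    (fun j x y => by
      have h1 := h j x y
      set a := f x - m with ha
      set d := f x - f (Function.update x j y) with hd
      have : f (Function.update x j y) - m = a - d := by rw [ha, hd]; ring
      rw [this]
      have e : (a ^ 2 - (a - d) ^ 2) ^ 2 = d ^ 2 * (2 * a - d) ^ 2 := by ring
      have h2 : (2 * a - d) ^ 2 ≤ 8 * a ^ 2 + 2 * d ^ 2 := by nlinarith [sq_nonneg (2 * a + d)]
      have hd2 := sq_nonneg d
      have ha2 := sq_nonneg a
      calc _ = d ^ 2 * (2 * a - d) ^ 2 := e
        _ ≤ d ^ 2 * (8 * a ^ 2 + 2 * d ^ 2) := by gcongr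
        _ ≤ B j x * (8 * a ^ 2 + 2 * B j x) := by gcongr; exact hB0 j x
        _ = D j x := by simp only [D, ha]; ring)
  rw [← hπ, hsum hD c' hDc] at hvar2
  have h3 : ∫ x, ∑ j, D j x ∂π ≤ ∫ x, (8 * C * (f x - m) ^ 2 + 2 * C ^ 2) ∂π := by
    refine integral_mono (integrable_finsetSum _ fun j _ =>
        integrable_of_measurable_of_abs_le (hD j) (hDc j))
      ((hi2.const_mul _).add (integrable_const _)) fun x => ?_
    simp only [D, Finset.sum_add_distrib, ← Finset.mul_sum]
    have h4 : ∑ j, B j x ^ 2 ≤ C ^ 2 :=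
      (Finset.sum_sq_le_sq_sum_of_nonneg fun j _ => hB0 j x).trans
        (pow_le_pow_left₀ (Finset.sum_nonneg fun j _ => hB0 j x) (hC x) 2)
    nlinarith [mul_le_mul_of_nonneg_left (hC x) (sq_nonneg (f x - m))]
  rw [integral_add (hi2.const_mul _) (integrable_const _), integral_const_mul] at h3
  simp only [integral_const, probReal_univ, smul_eq_mul, one_mul] at h3
  have h5 : (∫ x, (f x - m) ^ 2 ∂π) ^ 2 ≤ (C / 2) ^ 2 :=
    pow_le_pow_left₀ (integral_nonneg fun x => sq_nonneg _) hvar 2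
  have h6 : ∀ x, ((f x - m) ^ 2) ^ 2 = (f x - m) ^ 4 := fun x => by ring
  simp only [h6] at hvar2
  nlinarith [mul_le_mul_of_nonneg_left hvar hC0]

end EfronStein

/-! ### Lipschitz and influence bounds for the empirical characteristic function. -/

/-- The characteristic function at `t` of the empirical distribution of the Fourier coefficients
of `x` divided by `√N`. -/
noncomputable def empiricalCharFun {N : ℕ} [NeZero N] (t : ℂ) (x : ZMod N → ℝ) : ℂ :=
  (N : ℂ)⁻¹ * ∑ k, Complex.exp (Complex.I * (∑ j, fourierWeight t k j * x j : ℝ))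

section EmpiricalCharFun

variable {N : ℕ} [NeZero N]

theorem norm_exp_I_mul_ofReal (r : ℝ) : ‖Complex.exp (Complex.I * r)‖ = 1 := by
  rw [mul_comm, Complex.norm_exp_ofReal_mul_I]

theorem norm_exp_I_mul_sub_exp_I_mul_le (a b : ℝ) :
    ‖Complex.exp (Complex.I * a) - Complex.exp (Complex.I * b)‖ ≤ |a - b| := by
  have : Complex.exp (Complex.I * a) - Complex.exp (Complex.I * b) =
      Complex.exp (Complex.I * b) * (Complex.exp (Complex.I * ((a - b : ℝ) : ℂ)) - 1) := by
    rw [mul_sub, ← Complex.exp_add, mul_one]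
    congr 2
    push_cast
    ring
  rw [this, norm_mul, norm_exp_I_mul_ofReal, one_mul]
  exact Real.norm_exp_I_mul_ofReal_sub_one_le

theorem norm_exp_I_mul_sub_one_sub_le (r : ℝ) :
    ‖Complex.exp (Complex.I * r) - 1 - Complex.I * r‖ ≤ 2 * r ^ 2 := by
  have hr : ‖Complex.I * (r : ℂ)‖ = |r| := by simp
  rcases le_total |r| 1 with h | h
  · refine (Complex.norm_exp_sub_one_sub_id_le (hr ▸ h)).trans ?_
    rw [hr, sq_abs]
    nlinarith [sq_nonneg r]
  · refine (norm_sub_le _ _).trans ?_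
    have h1 : ‖Complex.exp (Complex.I * r) - 1‖ ≤ |r| := Real.norm_exp_I_mul_ofReal_sub_one_le
    rw [hr]
    nlinarith [sq_abs r]

theorem norm_empiricalCharFun_le (t : ℂ) (x : ZMod N → ℝ) : ‖empiricalCharFun t x‖ ≤ 1 := by
  have hN : (0 : ℝ) < N := by exact_mod_cast NeZero.pos N
  rw [empiricalCharFun, norm_mul, norm_inv, Complex.norm_natCast, inv_mul_le_iff₀ hN, mul_one]
  refine (norm_sum_le _ _).trans ?_
  simp only [norm_exp_I_mul_ofReal]
  simp [ZMod.card]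

theorem norm_average_exp_sub_le (a b : ZMod N → ℝ) :
    ‖(N : ℂ)⁻¹ * ∑ k, Complex.exp (Complex.I * a k) -
      (N : ℂ)⁻¹ * ∑ k, Complex.exp (Complex.I * b k)‖ ≤
      Real.sqrt ((∑ k, (a k - b k) ^ 2) / N) := by
  have hN : (0 : ℝ) < N := by exact_mod_cast NeZero.pos N
  rw [← mul_sub, ← Finset.sum_sub_distrib, norm_mul, norm_inv, Complex.norm_natCast]
  apply Real.le_sqrt_of_sq_le
  have h1 : ‖∑ k, (Complex.exp (Complex.I * a k) - Complex.exp (Complex.I * b k))‖ ≤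
      ∑ k, |a k - b k| :=
    (norm_sum_le _ _).trans (Finset.sum_le_sum fun k _ => norm_exp_I_mul_sub_exp_I_mul_le _ _)
  have h2 : (∑ k, |a k - b k|) ^ 2 ≤ N * ∑ k, (a k - b k) ^ 2 := by
    have := sq_sum_le_card_mul_sum_sq (s := Finset.univ) (f := fun k : ZMod N => |a k - b k|)
    simpa [ZMod.card] using this
  rw [mul_pow, inv_pow, inv_mul_le_iff₀ (by positivity)]
  refine (pow_le_pow_left₀ (norm_nonneg _) h1 2).trans (h2.trans (le_of_eq ?_))
  field_simp

theorem sum_sq_sum_fourierWeight_le (t : ℂ) (x : ZMod N → ℝ) :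
    ∑ k, (∑ j, fourierWeight t k j * x j) ^ 2 ≤ ‖t‖ ^ 2 * ∑ j, x j ^ 2 := by
  have := sum_norm_sq_sum_fourierWeight_le t (fun j => (x j : ℂ))
  simp only [← Complex.ofReal_mul, ← Complex.ofReal_sum, Complex.norm_real, Real.norm_eq_abs,
    sq_abs] at this
  simpa only [fourierWeight_comm t] using this

/-- The constant does not depend on `N`, so truncating the entries costs only their root mean square
change. -/
theorem norm_empiricalCharFun_sub_le (t : ℂ) (x y : ZMod N → ℝ) :
    ‖empiricalCharFun t x - empiricalCharFun t y‖ ≤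
      ‖t‖ * Real.sqrt ((∑ j, (x j - y j) ^ 2) / N) := by
  refine (norm_average_exp_sub_le _ _).trans ?_
  rw [← Real.sqrt_sq (norm_nonneg t), ← Real.sqrt_mul (sq_nonneg _), ← mul_div_assoc]
  apply Real.sqrt_le_sqrt
  gcongr
  simp only [← Finset.sum_sub_distrib, ← mul_sub]
  exact sum_sq_sum_fourierWeight_le t fun j => x j - y j

/-- This equicontinuity in `t` lets almost sure convergence on a countable dense set extend to all
`t`. -/
theorem norm_empiricalCharFun_sub_left_le (t s : ℂ) (x : ZMod N → ℝ) :
    ‖empiricalCharFun t x - empiricalCharFun s x‖ ≤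
      ‖t - s‖ * Real.sqrt ((∑ j, x j ^ 2) / N) := by
  refine (norm_average_exp_sub_le _ _).trans ?_
  rw [← Real.sqrt_sq (norm_nonneg (t - s)), ← Real.sqrt_mul (sq_nonneg _), ← mul_div_assoc]
  apply Real.sqrt_le_sqrt
  gcongr
  simp only [← Finset.sum_sub_distrib, ← sub_mul, ← fourierWeight_sub]
  exact sum_sq_sum_fourierWeight_le (t - s) x

theorem continuous_empiricalCharFun (t : ℂ) :
    Continuous fun x : ZMod N → ℝ => empiricalCharFun t x := by
  unfold empiricalCharFun
  fun_prop

/-- A bound for the squared effect on the empirical characteristic function of changing the `j`-th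
variable, when all variables are bounded by `K`. -/
noncomputable def influenceBound (t : ℂ) (K : ℝ) (j : ZMod N) (x : ZMod N → ℝ) : ℝ :=
  8 * K ^ 2 / N ^ 2 * ‖∑ k, (fourierWeight t k j : ℂ) *
    Complex.exp (Complex.I * (∑ j, fourierWeight t k j * x j : ℝ))‖ ^ 2 +
      128 * K ^ 4 * ‖t‖ ^ 4 / N ^ 2

theorem influenceBound_nonneg (t : ℂ) (K : ℝ) (j : ZMod N) (x : ZMod N → ℝ) :
    0 ≤ influenceBound t K j x := by
  unfold influenceBound; positivity

theorem continuous_influenceBound (t : ℂ) (K : ℝ) (j : ZMod N) :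
    Continuous (influenceBound t K j) := by
  unfold influenceBound
  fun_prop

/-- The Bessel-type bound is applied to the vector of exponentials, of squared norm `N`. Taking
absolute values term by term would lose a factor `N` and leave no decay. -/
theorem sum_influenceBound_le (t : ℂ) (K : ℝ) (x : ZMod N → ℝ) :
    ∑ j, influenceBound t K j x ≤ (8 * K ^ 2 * ‖t‖ ^ 2 + 128 * K ^ 4 * ‖t‖ ^ 4) / N := by
  have hN : (0 : ℝ) < N := by exact_mod_cast NeZero.pos N
  unfold influenceBound
  rw [Finset.sum_add_distrib, ← Finset.mul_sum]
  have := sum_norm_sq_sum_fourierWeight_le t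
    (fun k => Complex.exp (Complex.I * (∑ j, fourierWeight t k j * x j : ℝ)))
  simp only [norm_exp_I_mul_ofReal] at this
  simp only [one_pow, Finset.sum_const, Finset.card_univ, ZMod.card, nsmul_eq_mul, mul_one] at this ⊢
  calc _ ≤ 8 * K ^ 2 / N ^ 2 * (‖t‖ ^ 2 * N) + N * (128 * K ^ 4 * ‖t‖ ^ 4 / N ^ 2) := by gcongr
    _ = _ := by field_simp

/-- Expand each exponential to first order in the change `δ`. The linear part keeps its oscillation;
the remainder at each `k` is at most of order `1 / N`, since squared weights are. -/
theorem norm_empiricalCharFun_sub_update_sq_le (t : ℂ) {K : ℝ} (x : ZMod N → ℝ) (j : ZMod N)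
    (y : ℝ) (hx : |x j| ≤ K) (hy : |y| ≤ K) :
    ‖empiricalCharFun t x - empiricalCharFun t (Function.update x j y)‖ ^ 2 ≤
      influenceBound t K j x := by
  have hN : (0 : ℝ) < N := by exact_mod_cast NeZero.pos N
  set δ := y - x j with hδ
  have hδK : |δ| ≤ 2 * K := (abs_sub _ _).trans (by linarith)
  have hL : ∀ k, ∑ i, fourierWeight t k i * Function.update x j y i =
      (∑ i, fourierWeight t k i * x i) + fourierWeight t k j * δ := by
    intro k
    have : ∀ i, fourierWeight t k i * Function.update x j y i =
        fourierWeight t k i * x i + if i = j then fourierWeight t k j * δ else 0 := by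
      intro i
      by_cases h : i = j
      · subst h; simp [hδ]; ring
      · simp [h]
    simp only [this, Finset.sum_add_distrib, Finset.sum_ite_eq', Finset.mem_univ, if_true]
  set e : ZMod N → ℂ := fun k => Complex.exp (Complex.I * (∑ i, fourierWeight t k i * x i : ℝ))
  set R : ZMod N → ℂ := fun k => Complex.exp (Complex.I * (fourierWeight t k j * δ : ℝ)) - 1 -
    Complex.I * (fourierWeight t k j * δ : ℝ)
  have h1 : empiricalCharFun t x - empiricalCharFun t (Function.update x j y) =
      -((N : ℂ)⁻¹ * (Complex.I * δ * ∑ k, (fourierWeight t k j : ℂ) * e k + ∑ k, e k * R k)) := by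
    unfold empiricalCharFun
    rw [← mul_sub, ← Finset.sum_sub_distrib, ← mul_neg]
    congr 1
    rw [Finset.mul_sum, ← Finset.sum_add_distrib, ← Finset.sum_neg_distrib]
    refine Finset.sum_congr rfl fun k _ => ?_
    rw [hL, Complex.ofReal_add, mul_add, Complex.exp_add]
    simp only [e, R]
    push_cast
    ring
  have hR : ‖∑ k, e k * R k‖ ≤ 8 * K ^ 2 * ‖t‖ ^ 2 := by
    refine (norm_sum_le _ _).trans ?_
    have : ∀ k, ‖e k * R k‖ ≤ 8 * K ^ 2 * ‖t‖ ^ 2 / N := by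
      intro k
      rw [norm_mul, norm_exp_I_mul_ofReal, one_mul]
      refine (norm_exp_I_mul_sub_one_sub_le _).trans ?_
      have hw : fourierWeight t k j ^ 2 ≤ ‖t‖ ^ 2 / N := by
        rw [← sq_abs]
        refine (pow_le_pow_left₀ (abs_nonneg _) (abs_fourierWeight_le t k j) 2).trans (le_of_eq ?_)
        rw [div_pow, Real.sq_sqrt hN.le]
      have hd : δ ^ 2 ≤ (2 * K) ^ 2 := by
        rw [← sq_abs]; exact pow_le_pow_left₀ (abs_nonneg _) hδK 2
      rw [mul_pow]
      calc _ ≤ 2 * (‖t‖ ^ 2 / N * (2 * K) ^ 2) := by gcongr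
        _ = _ := by ring
    refine (Finset.sum_le_sum fun k _ => this k).trans (le_of_eq ?_)
    simp only [Finset.sum_const, Finset.card_univ, ZMod.card, nsmul_eq_mul]
    field_simp
  have h2 : ‖empiricalCharFun t x - empiricalCharFun t (Function.update x j y)‖ ≤
      (N : ℝ)⁻¹ * (2 * K * ‖∑ k, (fourierWeight t k j : ℂ) * e k‖ + 8 * K ^ 2 * ‖t‖ ^ 2) := by
    rw [h1, norm_neg, norm_mul, norm_inv, Complex.norm_natCast]
    gcongr
    refine (norm_add_le _ _).trans (add_le_add ?_ hR)
    rw [norm_mul, norm_mul, Complex.norm_I, one_mul, Complex.norm_real, Real.norm_eq_abs]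
    gcongr
  refine (pow_le_pow_left₀ (norm_nonneg _) h2 2).trans ?_
  unfold influenceBound
  change _ ≤ 8 * K ^ 2 / N ^ 2 * ‖∑ k, (fourierWeight t k j : ℂ) * e k‖ ^ 2 + _
  generalize ‖∑ k, (fourierWeight t k j : ℂ) * e k‖ = S
  -- The inequality `(a + b) ^ 2 ≤ 2 * a ^ 2 + 2 * b ^ 2`, which explains the constants `8` and
  -- `128`.
  have h3 : (2 * K * S + 8 * K ^ 2 * ‖t‖ ^ 2) ^ 2 ≤
      8 * K ^ 2 * S ^ 2 + 128 * K ^ 4 * ‖t‖ ^ 4 := by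
    nlinarith [sq_nonneg (2 * K * S - 8 * K ^ 2 * ‖t‖ ^ 2)]
  calc _ = (2 * K * S + 8 * K ^ 2 * ‖t‖ ^ 2) ^ 2 / N ^ 2 := by ring
    _ ≤ (8 * K ^ 2 * S ^ 2 + 128 * K ^ 4 * ‖t‖ ^ 4) / N ^ 2 := by gcongr
    _ = _ := by ring

end EmpiricalCharFun

/-- `ZMod (n + 1)` unfolds to `Fin (n + 1)`, so the bound transfers definitionally. -/
theorem integral_sub_integral_pow_four_le_zmod (μ : Measure ℝ)
    [IsProbabilityMeasure μ] (n : ℕ) (f : (ZMod (n + 1) → ℝ) → ℝ)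
    (B : ZMod (n + 1) → (ZMod (n + 1) → ℝ) → ℝ)
    (hf : Measurable f) (hB : ∀ j, Measurable (B j)) {c : ℝ} (hc : ∀ x, |f x| ≤ c)
    {C : ℝ} (hB0 : ∀ j x, 0 ≤ B j x) (hC : ∀ x, ∑ j, B j x ≤ C)
    (h : ∀ j x y, (f x - f (Function.update x j y)) ^ 2 ≤ B j x) :
    ∫ x, (f x - ∫ y, f y ∂(Measure.pi fun _ => μ)) ^ 4 ∂(Measure.pi fun _ => μ) ≤ 4 * C ^ 2 :=
  integral_sub_integral_pow_four_le (α := ℝ) μ (n + 1) f B hf hB hc hB0 hC h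

theorem norm_pow_four_le (z : ℂ) : ‖z‖ ^ 4 ≤ 2 * (z.re ^ 4 + z.im ^ 4) := by
  have : ‖z‖ ^ 4 = (z.re ^ 2 + z.im ^ 2) ^ 2 := by
    rw [show ‖z‖ ^ 4 = (‖z‖ ^ 2) ^ 2 by ring, Complex.sq_norm, Complex.normSq_apply]; ring
  rw [this]
  nlinarith [sq_nonneg (z.re ^ 2 - z.im ^ 2)]

/-- Real and imaginary parts are treated separately; recombining two bounds `4 * C ^ 2` through
`norm_pow_four_le` gives the factor `16`. -/
theorem integral_norm_empiricalCharFun_sub_pow_four_le (μ : Measure ℝ) [IsProbabilityMeasure μ]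
    (n : ℕ) (t : ℂ) {τ : ℝ → ℝ} (hτ : Continuous τ) {K : ℝ} (hK : ∀ r, |τ r| ≤ K) :
    ∫ x, ‖empiricalCharFun t (fun j : ZMod (n + 1) => τ (x j)) -
      ∫ y, empiricalCharFun t (fun j : ZMod (n + 1) => τ (y j)) ∂(Measure.pi fun _ => μ)‖ ^ 4
        ∂(Measure.pi fun _ => μ) ≤
      16 * ((8 * K ^ 2 * ‖t‖ ^ 2 + 128 * K ^ 4 * ‖t‖ ^ 4) / (n + 1 : ℕ)) ^ 2 := by
  set π := Measure.pi fun _ : ZMod (n + 1) => μ with hπ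
  set F : (ZMod (n + 1) → ℝ) → ℂ := fun x => empiricalCharFun t (fun j => τ (x j)) with hF
  set C := (8 * K ^ 2 * ‖t‖ ^ 2 + 128 * K ^ 4 * ‖t‖ ^ 4) / (n + 1 : ℕ)
  have hcomp : Continuous fun x : ZMod (n + 1) → ℝ => fun j => τ (x j) := by fun_prop
  have hFc : Continuous F := (continuous_empiricalCharFun t).comp hcomp
  have hF1 : ∀ x, ‖F x‖ ≤ 1 := fun x => norm_empiricalCharFun_le _ _
  have hFi : Integrable F π := Integrable.of_bound hFc.aestronglyMeasurable 1 (ae_of_all _ hF1)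
  have hupd : ∀ (x : ZMod (n + 1) → ℝ) j y,
      (fun i => τ (Function.update x j y i)) = Function.update (fun i => τ (x i)) j (τ y) := by
    intro x j y
    ext i
    by_cases h : i = j
    · subst h; simp
    · simp [h]
  have hdiff : ∀ j x y, ‖F x - F (Function.update x j y)‖ ^ 2 ≤
      influenceBound t K j (fun i => τ (x i)) := by
    intro j x y
    simp only [hF, hupd]
    exact norm_empiricalCharFun_sub_update_sq_le t _ j _ (hK _) (hK _)
  have hmain : ∀ (L : ℂ →L[ℝ] ℝ), (∀ z, |L z| ≤ ‖z‖) →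
      ∫ x, (L (F x - ∫ y, F y ∂π)) ^ 4 ∂π ≤ 4 * C ^ 2 := by
    intro L hL
    have := integral_sub_integral_pow_four_le_zmod μ n (fun x => L (F x))
      (fun j x => influenceBound t K j (fun i => τ (x i)))
      (L.continuous.comp hFc).measurable
      (fun j => ((continuous_influenceBound t K j).comp hcomp).measurable)
      (c := 1) (fun x => (hL _).trans (hF1 x))
      (fun j x => influenceBound_nonneg _ _ _ _) (fun x => sum_influenceBound_le t K _)
      (fun j x y => by
        rw [← map_sub, ← sq_abs]
        exact (pow_le_pow_left₀ (abs_nonneg _) (hL _) 2).trans (hdiff j x y))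
    rw [← hπ, L.integral_comp_comm hFi] at this
    simpa only [map_sub] using this
  have hre := hmain Complex.reCLM fun z => Complex.abs_re_le_norm z
  have him := hmain Complex.imCLM fun z => Complex.abs_im_le_norm z
  simp only [Complex.reCLM_apply, Complex.imCLM_apply] at hre him
  have hi : ∀ (L : ℂ →L[ℝ] ℝ), (∀ z, |L z| ≤ ‖z‖) →
      Integrable (fun x => (L (F x - ∫ y, F y ∂π)) ^ 4) π := by
    intro L hL
    refine integrable_of_measurable_of_abs_le (c := 2 ^ 4)
      (((L.continuous.comp (hFc.sub continuous_const)).pow 4).measurable) fun x => ?_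
    rw [abs_pow]
    refine pow_le_pow_left₀ (abs_nonneg _) ((hL _).trans ((norm_sub_le _ _).trans ?_)) 4
    have := norm_integral_le_of_norm_le_const (μ := π) (ae_of_all _ hF1)
    simp only [probReal_univ, mul_one] at this
    linarith [hF1 x]
  have hire := hi Complex.reCLM fun z => Complex.abs_re_le_norm z
  have hiim := hi Complex.imCLM fun z => Complex.abs_im_le_norm z
  simp only [Complex.reCLM_apply, Complex.imCLM_apply] at hire hiim
  calc _ ≤ ∫ x, 2 * ((F x - ∫ y, F y ∂π).re ^ 4 + (F x - ∫ y, F y ∂π).im ^ 4) ∂π :=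
        integral_mono_of_nonneg (ae_of_all _ fun x => by positivity)
          ((hire.add hiim).const_mul 2) (ae_of_all _ fun x => norm_pow_four_le _)
    _ = 2 * (∫ x, (F x - ∫ y, F y ∂π).re ^ 4 ∂π + ∫ x, (F x - ∫ y, F y ∂π).im ^ 4 ∂π) := by
        rw [integral_const_mul, integral_add hire hiim]
    _ ≤ 16 * C ^ 2 := by linarith

/-! ### Convergence of the mean characteristic function. -/

theorem norm_prod_sub_prod_le_sum {ι : Type*} (s : Finset ι) (a b : ι → ℂ)
    (ha : ∀ i, ‖a i‖ ≤ 1) (hb : ∀ i, ‖b i‖ ≤ 1) :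
    ‖∏ i ∈ s, a i - ∏ i ∈ s, b i‖ ≤ ∑ i ∈ s, ‖a i - b i‖ := by
  classical
  induction s using Finset.induction_on with
  | empty => simp
  | insert i s hi ih =>
    rw [Finset.prod_insert hi, Finset.prod_insert hi, Finset.sum_insert hi]
    have hp : ‖∏ i ∈ s, b i‖ ≤ 1 := by
      rw [norm_prod]
      exact Finset.prod_le_one (fun _ _ => norm_nonneg _) fun i _ => hb i
    calc ‖a i * ∏ i ∈ s, a i - b i * ∏ i ∈ s, b i‖
        = ‖a i * (∏ i ∈ s, a i - ∏ i ∈ s, b i) + (a i - b i) * ∏ i ∈ s, b i‖ := by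
          congr 1; ring
      _ ≤ ‖a i‖ * ‖∏ i ∈ s, a i - ∏ i ∈ s, b i‖ + ‖a i - b i‖ * ‖∏ i ∈ s, b i‖ := by
          refine (norm_add_le _ _).trans ?_
          rw [norm_mul, norm_mul]
      _ ≤ 1 * ‖∏ i ∈ s, a i - ∏ i ∈ s, b i‖ + ‖a i - b i‖ * 1 := by
          gcongr
          exact ha i
      _ ≤ _ := by linarith

theorem integral_empiricalCharFun {N : ℕ} [NeZero N] (μ : Measure ℝ) [IsProbabilityMeasure μ]
    (t : ℂ) :
    ∫ x, empiricalCharFun t x ∂(Measure.pi fun _ : ZMod N => μ) =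
      (N : ℂ)⁻¹ * ∑ k : ZMod N, ∏ j, charFun μ (fourierWeight t k j) := by
  unfold empiricalCharFun
  rw [integral_const_mul, integral_finsetSum]
  · congr 1
    refine Finset.sum_congr rfl fun k _ => ?_
    have : ∀ x : ZMod N → ℝ, Complex.exp (Complex.I * (∑ j, fourierWeight t k j * x j : ℝ)) =
        ∏ j, Complex.exp (fourierWeight t k j * x j * Complex.I) := by
      intro x
      rw [← Complex.exp_sum, ← Finset.sum_mul]
      push_cast
      rw [mul_comm]
    simp_rw [this]
    rw [integral_fintype_prod_eq_prod (𝕜 := ℂ)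
      (fun j (r : ℝ) => Complex.exp (fourierWeight t k j * r * Complex.I))]
    simp_rw [charFun_apply_real]
  · intro k _
    exact Integrable.of_bound (Continuous.aestronglyMeasurable (by fun_prop)) 1 (ae_of_all _ fun x => (norm_exp_I_mul_ofReal _).le)

theorem charFun_sub_exp_isLittleO {Ω : Type*} [MeasurableSpace Ω] {P : Measure Ω}
    [IsProbabilityMeasure P] {X : Ω → ℝ} (hX : AEMeasurable X P) (h0 : P[X] = 0)
    (h1 : P[X ^ 2] = 1) :
    (fun s : ℝ => charFun (P.map X) s - (Real.exp (-(s ^ 2 / 2)) : ℝ)) =o[𝓝 0]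
      fun s : ℝ => s ^ 2 := by
  have h2 : (fun s : ℝ => Real.exp (-(s ^ 2 / 2)) - 1 - (-(s ^ 2 / 2))) =o[𝓝 0]
      fun s : ℝ => s ^ 2 := by
    have h : (fun r : ℝ => Real.exp r - 1 - r) =o[𝓝 0] fun r : ℝ => r := by
      have := (Real.hasDerivAt_exp 0).isLittleO
      simpa using this
    have ht : Tendsto (fun s : ℝ => -(s ^ 2 / 2)) (𝓝 0) (𝓝 0) := by
      have : Continuous fun s : ℝ => -(s ^ 2 / 2) := by fun_prop
      simpa using this.tendsto 0
    refine (h.comp_tendsto ht).trans_isBigO ?_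
    refine Asymptotics.IsBigO.of_bound 1 (Eventually.of_forall fun s => ?_)
    simp only [Function.comp, Real.norm_eq_abs, abs_neg, abs_div, abs_pow, one_mul]
    have := sq_nonneg |s|
    rw [abs_two]
    linarith
  have h3 : (fun s : ℝ => (((Real.exp (-(s ^ 2 / 2)) - 1 - (-(s ^ 2 / 2)) : ℝ)) : ℂ)) =o[𝓝 0]
      fun s : ℝ => s ^ 2 := by
    rw [← Asymptotics.isLittleO_norm_left] at h2 ⊢
    simpa only [Complex.norm_real] using h2
  have h4 := taylor_charFun_two hX h0 h1
  have h5 : (fun s : ℝ => charFun (P.map X) s - (1 - (s : ℂ) ^ 2 / 2)) =o[𝓝 0]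
      fun s : ℝ => s ^ 2 := by simpa using h4
  refine (h5.sub h3).congr_left fun s => ?_
  push_cast
  ring

/-- By independence the mean is an average over `k` of products of characteristic functions at
weights of size `O(1/√N)`. Replacing each factor by the Gaussian one costs `o(1)` times the squared
weight, hence `o(1)` per product. If `k ≠ -k` the Gaussian product is exactly the limit; the other
frequencies add at most `2 / N`. -/
theorem tendsto_integral_empiricalCharFun {Ω : Type*} [MeasurableSpace Ω] {P : Measure Ω}
    [IsProbabilityMeasure P] {X : Ω → ℝ} (hX : AEMeasurable X P) (h0 : P[X] = 0)
    (h1 : P[X ^ 2] = 1) (t : ℂ) :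
    Tendsto (fun n : ℕ => ∫ x, empiricalCharFun t x
      ∂(Measure.pi fun _ : ZMod (n + 1) => P.map X)) atTop
      (𝓝 ((Real.exp (-(‖t‖ ^ 2 / 4)) : ℝ) : ℂ)) := by
  have hprob : IsProbabilityMeasure (P.map X) := Measure.isProbabilityMeasure_map hX
  rw [Metric.tendsto_atTop]
  intro ε hε
  -- Chosen so that `η * ‖t‖ ^ 2 ≤ ε / 2`; the `+ 1` keeps the denominator positive at `t = 0`.
  set η := ε / (2 * (‖t‖ ^ 2 + 1)) with hη
  have hη0 : 0 < η := by positivity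
  have hlo := (charFun_sub_exp_isLittleO hX h0 h1).bound hη0
  obtain ⟨δ, hδ, hδ'⟩ := Metric.eventually_nhds_iff.mp hlo
  have ht1 : Tendsto (fun n : ℕ => ‖t‖ / Real.sqrt ((n + 1 : ℕ) : ℝ)) atTop (𝓝 0) :=
    tendsto_const_nhds.div_atTop (Real.tendsto_sqrt_atTop.comp
      ((tendsto_natCast_atTop_atTop (R := ℝ)).comp (tendsto_add_atTop_nat 1)))
  have ht2 : Tendsto (fun n : ℕ => 2 / ((n + 1 : ℕ) : ℝ)) atTop (𝓝 0) :=
    tendsto_const_nhds.div_atTop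
      ((tendsto_natCast_atTop_atTop (R := ℝ)).comp (tendsto_add_atTop_nat 1))
  obtain ⟨n₀, hn₀⟩ := eventually_atTop.mp
    ((ht1.eventually (gt_mem_nhds hδ)).and (ht2.eventually (gt_mem_nhds (half_pos hε))))
  refine ⟨n₀, fun n hn => ?_⟩
  obtain ⟨hn1, hn2⟩ := hn₀ n hn
  set N := n + 1 with hNdef
  have hN : (0 : ℝ) < (N : ℕ) := by positivity
  have hw : ∀ k j : ZMod N, ‖charFun (P.map X) (fourierWeight t k j) -
      ((Real.exp (-(fourierWeight t k j ^ 2 / 2)) : ℝ) : ℂ)‖ ≤ η * fourierWeight t k j ^ 2 := by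
    intro k j
    have := hδ' (y := fourierWeight t k j) (by
      rw [Real.dist_eq, sub_zero]
      exact (abs_fourierWeight_le t k j).trans_lt hn1)
    simpa using this
  have hwsq : ∀ k : ZMod N, ∑ j, fourierWeight t k j ^ 2 ≤ ‖t‖ ^ 2 := by
    intro k
    calc ∑ j, fourierWeight t k j ^ 2 ≤ ∑ j : ZMod N, ‖t‖ ^ 2 / N := by
          refine Finset.sum_le_sum fun j _ => ?_
          rw [← sq_abs]
          refine (pow_le_pow_left₀ (abs_nonneg _) (abs_fourierWeight_le t k j) 2).trans
            (le_of_eq ?_)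
          rw [div_pow, Real.sq_sqrt hN.le]
      _ = ‖t‖ ^ 2 := by
          simp only [Finset.sum_const, Finset.card_univ, ZMod.card, nsmul_eq_mul]
          field_simp
  have hk : ∀ k : ZMod N, ‖∏ j, charFun (P.map X) (fourierWeight t k j) -
      ((Real.exp (-(‖t‖ ^ 2 / 4)) : ℝ) : ℂ)‖ ≤ η * ‖t‖ ^ 2 + if k = -k then 1 else 0 := by
    intro k
    have e1 : ‖∏ j, charFun (P.map X) (fourierWeight t k j) -
        ∏ j, ((Real.exp (-(fourierWeight t k j ^ 2 / 2)) : ℝ) : ℂ)‖ ≤ η * ‖t‖ ^ 2 := by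
      refine (norm_prod_sub_prod_le_sum _ _ _ (fun j => norm_charFun_le_one _) fun j => ?_).trans ?_
      · rw [Complex.norm_real, Real.norm_eq_abs, Real.abs_exp, Real.exp_le_one_iff]
        have := sq_nonneg (fourierWeight t k j)
        linarith
      · refine (Finset.sum_le_sum fun j _ => hw k j).trans ?_
        rw [← Finset.mul_sum]
        exact mul_le_mul_of_nonneg_left (hwsq k) hη0.le
    have e2 : ∏ j, ((Real.exp (-(fourierWeight t k j ^ 2 / 2)) : ℝ) : ℂ) =
        ((Real.exp (-((∑ j, fourierWeight t k j ^ 2) / 2)) : ℝ) : ℂ) := by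
      rw [← Complex.ofReal_prod, ← Real.exp_sum, Finset.sum_neg_distrib, Finset.sum_div]
    rw [e2] at e1
    split_ifs with hkk
    · refine (norm_sub_le_norm_sub_add_norm_sub _ _ _).trans (add_le_add e1 ?_)
      rw [← Complex.ofReal_sub, Complex.norm_real, Real.norm_eq_abs]
      have a1 : Real.exp (-((∑ j, fourierWeight t k j ^ 2) / 2)) ≤ 1 := by
        rw [Real.exp_le_one_iff]
        have := Finset.sum_nonneg fun j (_ : j ∈ Finset.univ) => sq_nonneg (fourierWeight t k j)
        linarith
      have a2 : Real.exp (-(‖t‖ ^ 2 / 4)) ≤ 1 := by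
        rw [Real.exp_le_one_iff]
        have := sq_nonneg ‖t‖
        linarith
      have a3 := Real.exp_pos (-((∑ j, fourierWeight t k j ^ 2) / 2))
      have a4 := Real.exp_pos (-(‖t‖ ^ 2 / 4))
      rw [abs_le]
      constructor <;> linarith
    · rw [sum_fourierWeight_sq t hkk] at e1
      rw [add_zero]
      have : ‖t‖ ^ 2 / 2 / 2 = ‖t‖ ^ 2 / 4 := by ring
      rwa [this] at e1
  rw [dist_eq_norm, integral_empiricalCharFun]
  have e3 : (N : ℂ)⁻¹ * ∑ k : ZMod N, ∏ j, charFun (P.map X) (fourierWeight t k j) -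
      ((Real.exp (-(‖t‖ ^ 2 / 4)) : ℝ) : ℂ) =
      (N : ℂ)⁻¹ * ∑ k : ZMod N, (∏ j, charFun (P.map X) (fourierWeight t k j) -
        ((Real.exp (-(‖t‖ ^ 2 / 4)) : ℝ) : ℂ)) := by
    have hNc : (N : ℂ) ≠ 0 := by exact_mod_cast hN.ne'
    rw [Finset.sum_sub_distrib, mul_sub]
    congr 1
    simp only [Finset.sum_const, Finset.card_univ, ZMod.card, nsmul_eq_mul]
    rw [inv_mul_cancel_left₀ hNc]
  rw [e3, norm_mul, norm_inv, Complex.norm_natCast]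
  have e4 : ‖∑ k : ZMod N, (∏ j, charFun (P.map X) (fourierWeight t k j) -
        ((Real.exp (-(‖t‖ ^ 2 / 4)) : ℝ) : ℂ))‖ ≤ N * (η * ‖t‖ ^ 2) + 2 := by
    refine (norm_sum_le _ _).trans ((Finset.sum_le_sum fun k _ => hk k).trans ?_)
    rw [Finset.sum_add_distrib]
    simp only [Finset.sum_const, Finset.card_univ, ZMod.card, nsmul_eq_mul, Finset.sum_boole]
    gcongr
    exact_mod_cast card_eq_neg_le_two
  calc (N : ℝ)⁻¹ * _ ≤ (N : ℝ)⁻¹ * (N * (η * ‖t‖ ^ 2) + 2) := by gcongr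
    _ = η * ‖t‖ ^ 2 + 2 / N := by field_simp
    _ < ε / 2 + ε / 2 := by
        refine add_lt_add_of_le_of_lt ?_ hn2
        rw [hη, div_mul_eq_mul_div, div_le_div_iff₀ (by positivity) (by positivity)]
        nlinarith
    _ = ε := by ring

/-! ### Almost sure convergence of the empirical characteristic function. -/

section AlmostSure

variable {Ω : Type*} [MeasurableSpace Ω] {P : Measure Ω}
  {X : ℕ → Ω → ℝ}

/-- The `N` entries of the first row of the reverse circulant matrix. -/
def entries (X : ℕ → Ω → ℝ) (N : ℕ) (ω : Ω) (j : ZMod N) : ℝ := X (j.val + 1) ω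

theorem aemeasurable_entries (hident : ∀ j, IdentDistrib (X j) (X 0) P P) (N : ℕ)
    [NeZero N] : AEMeasurable (entries X N) P :=
  aemeasurable_pi_iff.mpr fun j => (hident (j.val + 1)).aemeasurable_fst

theorem map_entries [IsProbabilityMeasure P] (hindep : iIndepFun X P) (hident : ∀ j, IdentDistrib (X j) (X 0) P P)
    (N : ℕ) [NeZero N] :
    P.map (entries X N) = Measure.pi fun _ : ZMod N => P.map (X 0) := by
  have hinj : Function.Injective fun j : ZMod N => j.val + 1 := fun i j h =>
    ZMod.val_injective N (Nat.succ_injective h)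
  have h := (iIndepFun_iff_map_fun_eq_pi_map
    fun j : ZMod N => (hident (j.val + 1)).aemeasurable_fst).mp (hindep.precomp hinj)
  unfold entries
  rw [h]
  congr 1
  funext j
  exact (hident _).map_eq

/-- The sum of the fourth powers has finite integral, so it is almost surely finite and its terms
tend to zero. -/
theorem ae_tendsto_zero_of_integral_pow_four_le {f : ℕ → Ω → ℝ} (hf0 : ∀ n ω, 0 ≤ f n ω)
    (hf : ∀ n, AEMeasurable (f n) P) (hfi : ∀ n, Integrable (fun ω => f n ω ^ 4) P) {c : ℕ → ℝ}
    (hc : Summable c) (h : ∀ n, ∫ ω, f n ω ^ 4 ∂P ≤ c n) :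
    ∀ᵐ ω ∂P, Tendsto (fun n => f n ω) atTop (𝓝 0) := by
  have hc0 : ∀ n, 0 ≤ c n := fun n =>
    (integral_nonneg fun ω => by have := hf0 n ω; positivity).trans (h n)
  have hm : ∀ n, AEMeasurable (fun ω => ENNReal.ofReal (f n ω ^ 4)) P := fun n =>
    ((hf n).pow_const 4).ennreal_ofReal
  have hfin : ∫⁻ ω, ∑' n, ENNReal.ofReal (f n ω ^ 4) ∂P ≠ ⊤ := by
    rw [lintegral_tsum hm]
    have : ∀ n, ∫⁻ ω, ENNReal.ofReal (f n ω ^ 4) ∂P ≤ ENNReal.ofReal (c n) := fun n => by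
      rw [← ofReal_integral_eq_lintegral_ofReal (hfi n)
        (ae_of_all _ fun ω => pow_nonneg (hf0 n ω) 4)]
      exact ENNReal.ofReal_le_ofReal (h n)
    refine ((ENNReal.tsum_le_tsum this).trans_lt ?_).ne
    rw [← ENNReal.ofReal_tsum_of_nonneg hc0 hc]
    exact ENNReal.ofReal_lt_top
  filter_upwards [ae_lt_top' (AEMeasurable.tsum hm) hfin] with ω hω
  have h1 := ENNReal.tendsto_atTop_zero_of_tsum_ne_top hω.ne
  have h2 : Tendsto (fun n => f n ω ^ 4) atTop (𝓝 0) := by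
    have := (ENNReal.tendsto_toReal ENNReal.zero_ne_top).comp h1
    simpa [Function.comp_def, ENNReal.toReal_ofReal (pow_nonneg (hf0 _ ω) 4)] using this
  have h3 := h2.rpow_const (p := (1 / 4 : ℝ)) (Or.inr (by norm_num))
  rw [Real.zero_rpow (by norm_num)] at h3
  refine h3.congr fun n => ?_
  rw [← Real.rpow_natCast, ← Real.rpow_mul (hf0 n ω)]
  norm_num

theorem ae_tendsto_empiricalCharFun_sub_integral [IsProbabilityMeasure P] (hindep : iIndepFun X P)
    (hident : ∀ j, IdentDistrib (X j) (X 0) P P) (t : ℂ) {τ : ℝ → ℝ} (hτ : Continuous τ) {K : ℝ}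
    (hK : ∀ r, |τ r| ≤ K) :
    ∀ᵐ ω ∂P, Tendsto (fun n : ℕ =>
      ‖empiricalCharFun t (fun j => τ (entries X (n + 1) ω j)) -
        ∫ y, empiricalCharFun t (fun j => τ (y j))
          ∂(Measure.pi fun _ : ZMod (n + 1) => P.map (X 0))‖) atTop (𝓝 0) := by
  have hprob : IsProbabilityMeasure (P.map (X 0)) :=
    Measure.isProbabilityMeasure_map (hident 0).aemeasurable_fst
  set A : ℝ := 8 * K ^ 2 * ‖t‖ ^ 2 + 128 * K ^ 4 * ‖t‖ ^ 4 with hA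
  let g : (n : ℕ) → (ZMod (n + 1) → ℝ) → ℝ := fun n x =>
    ‖empiricalCharFun t (fun j => τ (x j)) - ∫ y, empiricalCharFun t (fun j => τ (y j))
          ∂(Measure.pi fun _ : ZMod (n + 1) => P.map (X 0))‖
  have hg : ∀ n, Continuous (g n) := fun n => by
    refine continuous_norm.comp (Continuous.sub ?_ continuous_const)
    exact (continuous_empiricalCharFun t).comp (by fun_prop : Continuous fun x : ZMod (n + 1) → ℝ =>
      fun j => τ (x j))
  have hg2 : ∀ n x, g n x ≤ 2 := fun n x => by
    refine (norm_sub_le _ _).trans ?_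
    have h1 := norm_empiricalCharFun_le t (fun j => τ (x j))
    have h2 := norm_integral_le_of_norm_le_const
      (μ := Measure.pi fun _ : ZMod (n + 1) => P.map (X 0))
      (ae_of_all _ fun y : ZMod (n + 1) → ℝ => norm_empiricalCharFun_le t (fun j => τ (y j)))
    simp only [probReal_univ, mul_one] at h2
    linarith
  have hsum : Summable fun n : ℕ => 16 * (A / (n + 1 : ℕ)) ^ 2 := by
    have h1 : Summable fun n : ℕ => 1 / ((n : ℝ)) ^ 2 :=
      Real.summable_one_div_nat_pow.mpr one_lt_two
    have h2 := ((summable_nat_add_iff 1).mpr h1).mul_left (16 * A ^ 2)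
    refine h2.congr fun n => ?_
    rw [div_pow]
    ring
  refine ae_tendsto_zero_of_integral_pow_four_le (f := fun n ω => g n (entries X (n + 1) ω))
    (fun n ω => norm_nonneg _)
    (fun n => (hg n).measurable.comp_aemeasurable (aemeasurable_entries hident _))
    (fun n => ?_) hsum fun n => ?_
  · refine Integrable.of_bound (((hg n).measurable.comp_aemeasurable
      (aemeasurable_entries hident _)).pow_const 4).aestronglyMeasurable (2 ^ 4)
      (ae_of_all _ fun ω => ?_)
    rw [Real.norm_eq_abs, abs_pow]
    refine pow_le_pow_left₀ (abs_nonneg _) ?_ 4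
    rw [abs_of_nonneg (norm_nonneg _)]
    exact hg2 n _
  · have h1 := integral_norm_empiricalCharFun_sub_pow_four_le (P.map (X 0)) n t hτ hK
    rw [← map_entries hindep hident (n + 1), integral_map (aemeasurable_entries hident _)
      (by
        rw [map_entries hindep hident (n + 1)]
        exact ((hg n).pow 4).aestronglyMeasurable)] at h1
    simp only [g, ← map_entries hindep hident (n + 1)]
    exact h1

theorem ZMod.sum_val_eq_sum_range (g : ℕ → ℝ) (n : ℕ) :
    ∑ j : ZMod (n + 1), g j.val = ∑ i ∈ Finset.range (n + 1), g i :=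
  Fin.sum_univ_eq_sum_range g (n + 1)

theorem ae_tendsto_average_entries (hindep : iIndepFun X P)
    (hident : ∀ j, IdentDistrib (X j) (X 0) P P) {g : ℝ → ℝ} (hg : Measurable g)
    (hi : Integrable (fun ω => g (X 0 ω)) P) :
    ∀ᵐ ω ∂P, Tendsto (fun n : ℕ => (∑ j, g (entries X (n + 1) ω j)) / (n + 1 : ℕ)) atTop
      (𝓝 (∫ ω, g (X 0 ω) ∂P)) := by
  -- The entries have indices starting at `1`; `X 0` only represents the common law.
  have hid : ∀ i, IdentDistrib (fun ω => g (X (i + 1) ω)) (fun ω => g (X 0 ω)) P P :=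
    fun i => (hident (i + 1)).comp hg
  have h := strong_law_ae_real (fun i ω => g (X (i + 1) ω)) ((hid 0).integrable_iff.mpr hi)
    (fun i j hij => (hindep.indepFun (i := i + 1) (j := j + 1) (by simpa using hij)).comp hg hg)
    (fun i => (hid i).trans (hid 0).symm)
  filter_upwards [h] with ω hω
  have h2 := hω.comp (tendsto_add_atTop_nat 1)
  rw [(hid 0).integral_eq] at h2
  refine h2.congr fun n => ?_
  simp only [Function.comp, entries]
  rw [ZMod.sum_val_eq_sum_range fun i => g (X (i + 1) ω)]

/-- The Lipschitz bound is squared, integrated and compared by Jensen; all coordinates contribute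
equally, so `N` cancels. -/
theorem norm_integral_empiricalCharFun_sub_le {N : ℕ} [NeZero N] (μ : Measure ℝ)
    [IsProbabilityMeasure μ] (t : ℂ) {τ : ℝ → ℝ} (hτ : Continuous τ)
    (hi : Integrable (fun r => (r - τ r) ^ 2) μ) :
    ‖∫ x, empiricalCharFun t x ∂(Measure.pi fun _ : ZMod N => μ) -
      ∫ x, empiricalCharFun t (fun j => τ (x j)) ∂(Measure.pi fun _ : ZMod N => μ)‖ ≤
      ‖t‖ * Real.sqrt (∫ r, (r - τ r) ^ 2 ∂μ) := by
  have hN : (0 : ℝ) < N := by exact_mod_cast NeZero.pos N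
  set π := Measure.pi fun _ : ZMod N => μ with hπ
  have hc1 := continuous_empiricalCharFun (N := N) t
  have hc2 : Continuous fun x : ZMod N → ℝ => empiricalCharFun t (fun j => τ (x j)) :=
    hc1.comp (by fun_prop : Continuous fun x : ZMod N → ℝ => fun j => τ (x j))
  have hi1 : Integrable (fun x : ZMod N → ℝ => empiricalCharFun t x) π :=
    Integrable.of_bound hc1.aestronglyMeasurable 1
      (ae_of_all _ fun x => norm_empiricalCharFun_le _ _)
  have hi2 : Integrable (fun x : ZMod N → ℝ => empiricalCharFun t (fun j => τ (x j))) π :=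
    Integrable.of_bound hc2.aestronglyMeasurable 1
      (ae_of_all _ fun x => norm_empiricalCharFun_le _ _)
  rw [← integral_sub hi1 hi2]
  refine (norm_integral_le_integral_norm _).trans ?_
  rw [← Real.sqrt_sq (norm_nonneg t), ← Real.sqrt_mul (sq_nonneg _)]
  apply Real.le_sqrt_of_sq_le
  have hmem : MemLp (fun x : ZMod N → ℝ => ‖empiricalCharFun t x -
      empiricalCharFun t (fun j => τ (x j))‖) 2 π := by
    refine memLp_two_of_measurable_of_abs_le (c := 2) (hc1.sub hc2).norm.measurable fun x => ?_
    rw [abs_of_nonneg (norm_nonneg _)]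
    refine (norm_sub_le _ _).trans ?_
    linarith [norm_empiricalCharFun_le t x, norm_empiricalCharFun_le t (fun j => τ (x j))]
  refine (sq_integral_le_integral_sq hmem).trans ?_
  have hev : ∀ j : ZMod N, MeasurePreserving (Function.eval j) π μ :=
    fun j => measurePreserving_eval (fun _ : ZMod N => μ) j
  have hij : ∀ j : ZMod N, Integrable (fun x : ZMod N → ℝ => (x j - τ (x j)) ^ 2) π :=
    fun j => (hev j).integrable_comp_of_integrable hi
  have hval : ∀ j : ZMod N, ∫ x : ZMod N → ℝ, (x j - τ (x j)) ^ 2 ∂π =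
      ∫ r, (r - τ r) ^ 2 ∂μ := by
    intro j
    conv_rhs => rw [← (hev j).map_eq]
    rw [integral_map (measurable_pi_apply j).aemeasurable
      (by fun_prop : Continuous fun r : ℝ => (r - τ r) ^ 2).aestronglyMeasurable]
  calc _ ≤ ∫ x : ZMod N → ℝ, ‖t‖ ^ 2 * ((∑ j, (x j - τ (x j)) ^ 2) / N) ∂π := by
        refine integral_mono_of_nonneg (ae_of_all _ fun x => sq_nonneg _)
          (((integrable_finsetSum _ fun j _ => hij j).div_const _).const_mul _)
          (ae_of_all _ fun x => ?_)
        refine (pow_le_pow_left₀ (norm_nonneg _)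
          (norm_empiricalCharFun_sub_le t x (fun j => τ (x j))) 2).trans (le_of_eq ?_)
        rw [mul_pow, Real.sq_sqrt (by positivity)]
    _ = ‖t‖ ^ 2 * ∫ r, (r - τ r) ^ 2 ∂μ := by
        rw [integral_const_mul, integral_div, integral_finsetSum _ fun j _ => hij j]
        simp only [hval, Finset.sum_const, Finset.card_univ, ZMod.card, nsmul_eq_mul]
        field_simp

/-- Truncation at level `M`. -/
def truncate (M r : ℝ) : ℝ := max (-M) (min r M)

theorem continuous_truncate (M : ℝ) : Continuous (truncate M) := by
  unfold truncate; fun_prop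

theorem abs_truncate_le {M : ℝ} (hM : 0 ≤ M) (r : ℝ) : |truncate M r| ≤ M := by
  unfold truncate
  rw [abs_le]
  exact ⟨le_max_left _ _, max_le (by linarith) (min_le_right _ _)⟩

theorem truncate_eq_self {M r : ℝ} (h : |r| ≤ M) : truncate M r = r := by
  unfold truncate
  rw [min_eq_left (abs_le.mp h).2, max_eq_right (abs_le.mp h).1]

theorem abs_sub_truncate_le {M : ℝ} (hM : 0 ≤ M) (r : ℝ) : |r - truncate M r| ≤ |r| := by
  unfold truncate
  rcases le_total r M with h | h <;> rcases le_total (-M) r with h' | h'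
  · rw [min_eq_left h, max_eq_right h']; simp
  · rw [min_eq_left h, max_eq_left h', abs_of_nonpos (by linarith), abs_of_nonpos (by linarith)]
    linarith
  · rw [min_eq_right h, max_eq_right (by linarith), abs_of_nonneg (by linarith),
      abs_of_nonneg (by linarith)]
    linarith
  · rw [min_eq_right h, max_eq_right (by linarith), abs_of_nonneg (by linarith),
      abs_of_nonneg (by linarith)]
    linarith

theorem sq_sub_truncate_le {M : ℝ} (hM : 0 ≤ M) (r : ℝ) : (r - truncate M r) ^ 2 ≤ r ^ 2 := by
  rw [← sq_abs, ← sq_abs r]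
  exact pow_le_pow_left₀ (abs_nonneg _) (abs_sub_truncate_le hM r) 2

theorem integrable_sq_sub_truncate {μ : Measure ℝ} (hi : Integrable (fun r => r ^ 2) μ) (M : ℕ) :
    Integrable (fun r => (r - truncate M r) ^ 2) μ := by
  refine hi.mono ((continuous_id.sub (continuous_truncate _)).pow 2).aestronglyMeasurable
    (ae_of_all _ fun r => ?_)
  rw [Real.norm_of_nonneg (sq_nonneg _), Real.norm_of_nonneg (sq_nonneg _)]
  exact sq_sub_truncate_le (Nat.cast_nonneg M) r

theorem tendsto_integral_sq_sub_truncate {μ : Measure ℝ} (hi : Integrable (fun r => r ^ 2) μ) :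
    Tendsto (fun M : ℕ => ∫ r, (r - truncate M r) ^ 2 ∂μ) atTop (𝓝 0) := by
  have := tendsto_integral_of_dominated_convergence (μ := μ)
    (F := fun (M : ℕ) r => (r - truncate M r) ^ 2) (f := fun _ => 0) (fun r => r ^ 2)
    (fun M => (integrable_sq_sub_truncate hi M).aestronglyMeasurable) hi
    (fun M => ae_of_all _ fun r => by
      rw [Real.norm_of_nonneg (sq_nonneg _)]
      exact sq_sub_truncate_le (Nat.cast_nonneg M) r)
    (ae_of_all _ fun r => by
      refine tendsto_const_nhds.congr' ?_
      filter_upwards [eventually_ge_atTop ⌈|r|⌉₊] with M hM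
      rw [truncate_eq_self (Nat.ceil_le.mp hM)]
      simp)
  simpa using this

/-- Four errors below `ε / 4`: truncation of the sample (strong law), fluctuation of the truncated
sample (fourth moments), truncation inside the mean, and convergence of the untruncated mean. The
truncated law need not be recentred or rescaled, since its mean characteristic function is only an
intermediate term. -/
theorem ae_tendsto_empiricalCharFun [IsProbabilityMeasure P] (hindep : iIndepFun X P)
    (hident : ∀ j, IdentDistrib (X j) (X 0) P P) (h0 : P[X 0] = 0) (h1 : P[X 0 ^ 2] = 1) (t : ℂ) :
    ∀ᵐ ω ∂P, Tendsto (fun n : ℕ => empiricalCharFun t (entries X (n + 1) ω)) atTop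
      (𝓝 ((Real.exp (-(‖t‖ ^ 2 / 4)) : ℝ) : ℂ)) := by
  have hX0 := (hident 0).aemeasurable_fst
  have hprob : IsProbabilityMeasure (P.map (X 0)) := Measure.isProbabilityMeasure_map hX0
  set μ := P.map (X 0) with hμ
  have hi : Integrable (fun r => r ^ 2) μ := by
    rw [hμ, integrable_map_measure (by fun_prop) hX0]
    -- A non-integrable function has integral `0` by convention, so the value `1` forces
    -- integrability.
    exact Integrable.of_integral_ne_zero (by
      change ∫ ω, X 0 ω ^ 2 ∂P ≠ 0
      have : ∫ ω, X 0 ω ^ 2 ∂P = 1 := h1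
      rw [this]; exact one_ne_zero)
  have hA := ae_all_iff.mpr fun M : ℕ => ae_tendsto_empiricalCharFun_sub_integral hindep hident t
    (continuous_truncate M) (abs_truncate_le (Nat.cast_nonneg M))
  have hcont : ∀ M : ℕ, Continuous fun r : ℝ => (r - truncate M r) ^ 2 := fun M =>
    (continuous_id.sub (continuous_truncate _)).pow 2
  have hB := ae_all_iff.mpr fun M : ℕ => ae_tendsto_average_entries hindep hident
    (g := fun r => (r - truncate M r) ^ 2) (hcont M).measurable
    ((integrable_map_measure (hcont M).aestronglyMeasurable hX0).mp
      (integrable_sq_sub_truncate hi M))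
  have hE := tendsto_integral_empiricalCharFun hX0 h0 h1 t
  filter_upwards [hA, hB] with ω hωA hωB
  rw [Metric.tendsto_atTop]
  intro ε hε
  have hV : Tendsto (fun M : ℕ => ‖t‖ * Real.sqrt (∫ r, (r - truncate M r) ^ 2 ∂μ)) atTop
      (𝓝 0) := by
    simpa using ((tendsto_integral_sq_sub_truncate hi).sqrt).const_mul ‖t‖
  obtain ⟨M, hM⟩ := (hV.eventually (gt_mem_nhds (show 0 < ε / 4 by positivity))).exists
  have hBM : Tendsto (fun n : ℕ => ‖t‖ * Real.sqrt
      ((∑ j, (entries X (n + 1) ω j - truncate M (entries X (n + 1) ω j)) ^ 2) / (n + 1 : ℕ)))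
      atTop (𝓝 (‖t‖ * Real.sqrt (∫ r, (r - truncate M r) ^ 2 ∂μ))) := by
    have := hωB M
    rw [← integral_map (f := fun r => (r - truncate M r) ^ 2) hX0
      (hcont M).aestronglyMeasurable] at this
    exact this.sqrt.const_mul _
  have hev := ((hBM.eventually (gt_mem_nhds hM)).and
    ((hωA M).eventually (gt_mem_nhds (show 0 < ε / 4 by positivity)))).and
    (Metric.tendsto_nhds.mp hE (ε / 4) (by positivity))
  obtain ⟨n₀, hn₀⟩ := eventually_atTop.mp hev
  refine ⟨n₀, fun n hn => ?_⟩
  obtain ⟨⟨e1, e2⟩, e3⟩ := hn₀ n hn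
  have e4 := norm_empiricalCharFun_sub_le t (entries X (n + 1) ω)
    (fun j => truncate M (entries X (n + 1) ω j))
  have e5 := norm_integral_empiricalCharFun_sub_le (N := n + 1) μ t (continuous_truncate M)
    (integrable_sq_sub_truncate hi M)
  rw [norm_sub_rev] at e5
  rw [dist_eq_norm] at e3 ⊢
  set a := empiricalCharFun t (entries X (n + 1) ω)
  set b := empiricalCharFun t (fun j => truncate M (entries X (n + 1) ω j))
  set c := ∫ x, empiricalCharFun t (fun j => truncate M (x j))
    ∂(Measure.pi fun _ : ZMod (n + 1) => μ)
  set d := ∫ x, empiricalCharFun t x ∂(Measure.pi fun _ : ZMod (n + 1) => μ)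
  set l := ((Real.exp (-(‖t‖ ^ 2 / 4)) : ℝ) : ℂ)
  have : a - l = (a - b) + (b - c) + (c - d) + (d - l) := by ring
  rw [this]
  have t1 := norm_add_le ((a - b) + (b - c) + (c - d)) (d - l)
  have t2 := norm_add_le ((a - b) + (b - c)) (c - d)
  have t3 := norm_add_le (a - b) (b - c)
  linarith

theorem ae_forall_tendsto_empiricalCharFun [IsProbabilityMeasure P] (hindep : iIndepFun X P)
    (hident : ∀ j, IdentDistrib (X j) (X 0) P P) (h0 : P[X 0] = 0) (h1 : P[X 0 ^ 2] = 1) :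
    ∀ᵐ ω ∂P, ∀ t : ℂ, Tendsto (fun n : ℕ => empiricalCharFun t (entries X (n + 1) ω)) atTop
      (𝓝 ((Real.exp (-(‖t‖ ^ 2 / 4)) : ℝ) : ℂ)) := by
  have hA := ae_all_iff.mpr fun i : ℕ =>
    ae_tendsto_empiricalCharFun hindep hident h0 h1 (TopologicalSpace.denseSeq ℂ i)
  have hB := ae_tendsto_average_entries hindep hident (g := fun r => r ^ 2) (by fun_prop)
    (Integrable.of_integral_ne_zero (by
      have : ∫ ω, X 0 ω ^ 2 ∂P = 1 := h1
      rw [this]; exact one_ne_zero))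
  filter_upwards [hA, hB] with ω hωA hωB t
  have h1' : ∫ ω, X 0 ω ^ 2 ∂P = 1 := h1
  rw [h1'] at hωB
  rw [Metric.tendsto_atTop]
  intro ε hε
  have hcont : Continuous fun s : ℂ => ((Real.exp (-(‖s‖ ^ 2 / 4)) : ℝ) : ℂ) := by fun_prop
  obtain ⟨δ, hδ, hδ'⟩ := Metric.continuous_iff.mp hcont t (ε / 3) (by positivity)
  obtain ⟨i, hi⟩ := (TopologicalSpace.denseRange_denseSeq ℂ).exists_dist_lt t
    (show 0 < min δ (ε / 6) by positivity)
  set s := TopologicalSpace.denseSeq ℂ i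
  have hi1 : dist s t < δ := by rw [dist_comm]; exact hi.trans_le (min_le_left _ _)
  have hi2 : ‖t - s‖ < ε / 6 := by rw [← dist_eq_norm]; exact hi.trans_le (min_le_right _ _)
  -- The root mean square of the entries tends to `1`, so `2` eventually serves as Lipschitz
  -- constant in `t`; hence `ε / 6` for the distance to the dense point.
  have hev := (hωB.sqrt.eventually (gt_mem_nhds (show Real.sqrt 1 < 2 by simp))).and
    (Metric.tendsto_nhds.mp (hωA i) (ε / 3) (by positivity))
  obtain ⟨n₀, hn₀⟩ := eventually_atTop.mp hev
  refine ⟨n₀, fun n hn => ?_⟩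
  obtain ⟨e1, e2⟩ := hn₀ n hn
  have e3 := norm_empiricalCharFun_sub_left_le t s (entries X (n + 1) ω)
  have e4 := hδ' s hi1
  have e5 : ‖t - s‖ * Real.sqrt ((∑ j, entries X (n + 1) ω j ^ 2) / (n + 1 : ℕ)) ≤ ε / 6 * 2 :=
    mul_le_mul hi2.le e1.le (Real.sqrt_nonneg _) (by positivity)
  rw [← dist_eq_norm] at e3
  have t1 := dist_triangle4 (empiricalCharFun t (entries X (n + 1) ω))
    (empiricalCharFun s (entries X (n + 1) ω)) ((Real.exp (-(‖s‖ ^ 2 / 4)) : ℝ) : ℂ)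
    ((Real.exp (-(‖t‖ ^ 2 / 4)) : ℝ) : ℂ)
  linarith

end AlmostSure

/-! ### Empirical measures, the complex Gaussian and the symmetrized Rayleigh law. -/

/-- The uniform distribution on a finite family of points, counted with multiplicity. -/
noncomputable def empiricalMeasure {ι : Type*} [Fintype ι] [Nonempty ι] {E : Type*}
    [MeasurableSpace E] (z : ι → E) : ProbabilityMeasure E :=
  ⟨(Fintype.card ι : ENNReal)⁻¹ • ∑ k, Measure.dirac (z k), ⟨by
    simp only [Measure.smul_apply, Measure.finsetSum_apply, measure_univ, Finset.sum_const,
      Finset.card_univ, nsmul_eq_mul, mul_one, smul_eq_mul]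
    exact ENNReal.inv_mul_cancel (by simp) (by simp)⟩⟩

theorem integral_empiricalMeasure {ι : Type*} [Fintype ι] [Nonempty ι] {E : Type*}
    [MeasurableSpace E] [MeasurableSingletonClass E] {F : Type*} [NormedAddCommGroup F]
    [NormedSpace ℝ F] [CompleteSpace F] (z : ι → E) (f : E → F) :
    ∫ x, f x ∂(empiricalMeasure z : Measure E) = (Fintype.card ι : ℝ)⁻¹ • ∑ k, f (z k) := by
  change ∫ x, f x ∂((Fintype.card ι : ENNReal)⁻¹ • ∑ k, Measure.dirac (z k)) = _
  rw [integral_smul_measure, integral_finsetSum_measure]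
  · simp [integral_dirac]
  · intro k _
    exact integrable_dirac (by simp)

theorem esd_eq_empiricalMeasure {ι : Type*} [Fintype ι] [DecidableEq ι] [Nonempty ι]
    (A : Matrix ι ι ℝ) (hA : A.IsHermitian) : esd A hA = empiricalMeasure hA.eigenvalues := rfl

theorem integrable_exp_neg_norm_sq : Integrable fun z : ℂ => Real.exp (-‖z‖ ^ 2) := by
  have h := (GaussianFourier.integrable_cexp_neg_mul_sq_norm_add (b := 1) (V := ℂ) (by simp) 0 0).re
  refine h.congr (ae_of_all _ fun z => ?_)
  simp only [neg_mul, one_mul, zero_mul, add_zero, RCLike.re_to_complex]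
  rw [← Complex.ofReal_pow, ← Complex.ofReal_neg, Complex.exp_ofReal_re]

theorem integral_exp_neg_norm_sq_mul_exp_inner (t : ℂ) :
    ∫ z : ℂ, (Real.exp (-‖z‖ ^ 2) : ℂ) * Complex.exp (inner ℝ z t * Complex.I) =
      Real.pi * (Real.exp (-(‖t‖ ^ 2 / 4)) : ℝ) := by
  have h := GaussianFourier.integral_cexp_neg_mul_sq_norm_add (b := 1) (V := ℂ) (by simp)
    Complex.I t
  have h2 : ∀ z : ℂ, (Real.exp (-‖z‖ ^ 2) : ℂ) * Complex.exp (inner ℝ z t * Complex.I) =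
      Complex.exp (-1 * (‖z‖ : ℂ) ^ 2 + Complex.I * (inner ℝ t z : ℝ)) := by
    intro z
    rw [Complex.exp_add, real_inner_comm, mul_comm Complex.I]
    push_cast
    ring_nf
  simp_rw [h2]
  rw [h, Complex.finrank_real_complex]
  push_cast
  norm_num [Complex.I_sq]
  ring_nf

theorem integral_exp_neg_norm_sq : ∫ z : ℂ, Real.exp (-‖z‖ ^ 2) = Real.pi := by
  have h := integral_exp_neg_norm_sq_mul_exp_inner 0
  simp only [inner_zero_right, Complex.ofReal_zero, zero_mul, Complex.exp_zero, mul_one,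
    norm_zero] at h
  rw [integral_complex_ofReal] at h
  norm_num at h
  exact_mod_cast h

/-- The standard complex Gaussian distribution, with density `exp (-‖z‖ ^ 2) / π`. -/
noncomputable def complexGaussian : ProbabilityMeasure ℂ :=
  ⟨(volume : Measure ℂ).withDensity fun z => ENNReal.ofReal (Real.pi⁻¹ * Real.exp (-‖z‖ ^ 2)),
    ⟨by
      rw [withDensity_apply _ MeasurableSet.univ, Measure.restrict_univ,
        ← ofReal_integral_eq_lintegral_ofReal (integrable_exp_neg_norm_sq.const_mul _)
          (ae_of_all _ fun z => by positivity), integral_const_mul, integral_exp_neg_norm_sq,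
        inv_mul_cancel₀ Real.pi_ne_zero, ENNReal.ofReal_one]⟩⟩

theorem integral_complexGaussian {F : Type*} [NormedAddCommGroup F] [NormedSpace ℝ F]
    (f : ℂ → F) :
    ∫ z, f z ∂(complexGaussian : Measure ℂ) =
      ∫ z, (Real.pi⁻¹ * Real.exp (-‖z‖ ^ 2)) • f z := by
  change ∫ z, f z ∂((volume : Measure ℂ).withDensity
    fun z => ENNReal.ofReal (Real.pi⁻¹ * Real.exp (-‖z‖ ^ 2))) = _
  rw [integral_withDensity_eq_integral_toReal_smul (by fun_prop) (by simp)]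
  refine integral_congr_ae (ae_of_all _ fun z => ?_)
  simp only
  rw [ENNReal.toReal_ofReal (by positivity)]

theorem charFun_complexGaussian (t : ℂ) :
    charFun (complexGaussian : Measure ℂ) t = ((Real.exp (-(‖t‖ ^ 2 / 4)) : ℝ) : ℂ) := by
  rw [charFun_apply, integral_complexGaussian]
  have : ∀ z : ℂ, (Real.pi⁻¹ * Real.exp (-‖z‖ ^ 2)) • Complex.exp (inner ℝ z t * Complex.I) =
      (Real.pi⁻¹ : ℂ) *
        ((Real.exp (-‖z‖ ^ 2) : ℂ) * Complex.exp (inner ℝ z t * Complex.I)) := by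
    intro z
    rw [Complex.real_smul]
    push_cast
    ring
  simp_rw [this]
  rw [integral_const_mul, integral_exp_neg_norm_sq_mul_exp_inner, inv_mul_cancel_left₀]
  exact_mod_cast Real.pi_ne_zero

theorem integral_symRayleigh (f : ℝ → ℝ) :
    ∫ x, f x ∂(symRayleigh : Measure ℝ) = ∫ x, |x| * Real.exp (-x ^ 2) * f x := by
  change ∫ x, f x ∂((volume : Measure ℝ).withDensity
    fun x => ENNReal.ofReal (|x| * Real.exp (-x ^ 2))) = _
  rw [integral_withDensity_eq_integral_toReal_smul (by fun_prop)
    (ae_of_all _ fun x => ENNReal.ofReal_lt_top)]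
  refine integral_congr_ae (ae_of_all _ fun z => ?_)
  simp only
  rw [ENNReal.toReal_ofReal (by positivity), smul_eq_mul]

/-- By evenness the integral is twice that of `r ^ (2 * p + 1) * exp (-r ^ 2)` on the half-line,
which is `Γ(p + 1)`. -/
theorem integral_symRayleigh_pow (p : ℕ) :
    ∫ x : ℝ, x ^ (2 * p) ∂(symRayleigh : Measure ℝ) = (p.factorial : ℝ) := by
  rw [integral_symRayleigh]
  have h1 : ∀ x : ℝ, |x| * Real.exp (-x ^ 2) * x ^ (2 * p) =
      (fun r : ℝ => r ^ (2 * p + 1) * Real.exp (-r ^ 2)) |x| := by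
    intro x
    simp only
    rw [pow_succ |x|, pow_mul |x|, sq_abs, ← pow_mul]
    ring
  rw [integral_congr_ae (ae_of_all _ h1),
    integral_comp_abs (f := fun r : ℝ => r ^ (2 * p + 1) * Real.exp (-r ^ 2))]
  have h2 := integral_rpow_mul_exp_neg_rpow (p := 2) (q := ((2 * p + 1 : ℕ) : ℝ)) (by norm_num)
    (by have : (0 : ℝ) ≤ ((2 * p + 1 : ℕ) : ℝ) := Nat.cast_nonneg _
        linarith)
  simp only [Real.rpow_natCast, Real.rpow_ofNat] at h2
  rw [h2]
  have h3 : (((2 * p + 1 : ℕ) : ℝ) + 1) / 2 = p + 1 := by push_cast; ring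
  rw [h3, Real.Gamma_nat_eq_factorial]
  ring

theorem integrable_abs_mul_exp_neg_sq : Integrable fun x : ℝ => |x| * Real.exp (-x ^ 2) := by
  have h := (integrable_mul_exp_neg_mul_sq (b := 1) one_pos).norm
  simpa [abs_mul, Real.abs_exp] using h

/-- In polar coordinates the Gaussian modulus has density `2 * r * exp (-r ^ 2)` on the half-line;
symmetrizing shares this mass equally between both signs. -/
theorem integral_complexGaussian_symmetrized_norm (f : BoundedContinuousFunction ℝ ℝ) :
    ∫ z, (f ‖z‖ + f (-‖z‖)) / 2 ∂(complexGaussian : Measure ℂ) =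
      ∫ x, f x ∂(symRayleigh : Measure ℝ) := by
  have hi : Integrable fun x : ℝ => |x| * Real.exp (-x ^ 2) * f x :=
    integrable_abs_mul_exp_neg_sq.mul_bdd f.continuous.aestronglyMeasurable
      (ae_of_all _ f.norm_coe_le_norm)
  have hneg : ∫ x : ℝ, |x| * Real.exp (-x ^ 2) * f (-x) = ∫ x : ℝ, |x| * Real.exp (-x ^ 2) * f x := by
    have := integral_neg_eq_self (fun x : ℝ => |x| * Real.exp (-x ^ 2) * f x) volume
    simpa using this
  have hineg : Integrable fun x : ℝ => |x| * Real.exp (-x ^ 2) * f (-x) := by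
    simpa using hi.comp_neg
  have h1 : ∫ x, f x ∂(symRayleigh : Measure ℝ) =
      2 * ∫ x in Set.Ioi (0 : ℝ), x * Real.exp (-x ^ 2) * ((f x + f (-x)) / 2) := by
    rw [integral_symRayleigh, ← integral_comp_abs
      (f := fun x => x * Real.exp (-x ^ 2) * ((f x + f (-x)) / 2))]
    have h2 : ∀ x : ℝ, |x| * Real.exp (-|x| ^ 2) * ((f |x| + f (-|x|)) / 2) =
        (|x| * Real.exp (-x ^ 2) * f x + |x| * Real.exp (-x ^ 2) * f (-x)) / 2 := by
      intro x
      rw [sq_abs]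
      rcases abs_choice x with h | h <;> rw [h] <;> ring_nf
    simp_rw [h2]
    rw [integral_div, integral_add hi hineg, hneg]
    ring
  rw [h1, integral_complexGaussian]
  have h3 := integral_fun_norm_addHaar (volume : Measure ℂ)
    (fun r => (Real.pi⁻¹ * Real.exp (-r ^ 2)) • ((f r + f (-r)) / 2))
  rw [h3, Complex.finrank_real_complex, Measure.real, Complex.volume_ball]
  simp only [nsmul_eq_mul, smul_eq_mul, Nat.add_one_sub_one, pow_one, ENNReal.ofReal_one, one_pow,
    one_mul, ENNReal.coe_toReal, NNReal.coe_real_pi]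
  have h4 : ∀ y : ℝ, y * (Real.pi⁻¹ * Real.exp (-y ^ 2) * ((f y + f (-y)) / 2)) =
      Real.pi⁻¹ * (y * Real.exp (-y ^ 2) * ((f y + f (-y)) / 2)) := fun y => by ring
  simp_rw [h4]
  rw [integral_const_mul, mul_inv_cancel_left₀ Real.pi_ne_zero]
  norm_num

/-! ### From the planar Gaussian limit to the spectral distribution. -/

theorem charFun_empiricalMeasure_fourierCoeffZMod {N : ℕ} [NeZero N] (t : ℂ) (x : ZMod N → ℝ) :
    charFun (empiricalMeasure (fourierCoeffZMod fun j => x j / Real.sqrt N) : Measure ℂ) t =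
      empiricalCharFun t x := by
  rw [charFun_apply, integral_empiricalMeasure, empiricalCharFun, ZMod.card, Complex.real_smul]
  simp only [inner_fourierCoeffZMod, mul_comm Complex.I]
  push_cast
  rfl

theorem integral_esd_revCirculant (n : ℕ) (c : ℕ → ℝ) (f : ℝ → ℝ) :
    ∫ x, f x ∂(esd (revCirculant (n + 1) c) (revCirculant_isHermitian _ _) : Measure ℝ) =
      (∫ z, (f ‖z‖ + f (-‖z‖)) / 2 ∂(empiricalMeasure
        (fourierCoeffZMod fun j : ZMod (n + 1) => c (j.val + 1)) : Measure ℂ)) +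
      ((n + 1 : ℕ) : ℝ)⁻¹ * ∑ k : ZMod (n + 1) with k = -k,
        (f (fourierCoeffZMod (fun j : ZMod (n + 1) => c (j.val + 1)) k).re -
          f (-(fourierCoeffZMod (fun j : ZMod (n + 1) => c (j.val + 1)) k).re)) / 2 := by
  -- Quantifying over `A` lets the equality with the `ZMod`-indexed matrix be substituted together
  -- with the Hermitian proof on which the eigenvalues depend.
  have key : ∀ A : Matrix (ZMod (n + 1)) (ZMod (n + 1)) ℝ,
      A = Matrix.of (fun i j : ZMod (n + 1) => c ((i + j).val + 1)) → ∀ hA : A.IsHermitian,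
      ∑ k, f (hA.eigenvalues k) =
        ∑ k, (f ‖fourierCoeffZMod (fun j : ZMod (n + 1) => c (j.val + 1)) k‖ +
          f (-‖fourierCoeffZMod (fun j : ZMod (n + 1) => c (j.val + 1)) k‖)) / 2 +
        ∑ k : ZMod (n + 1) with k = -k,
          (f (fourierCoeffZMod (fun j : ZMod (n + 1) => c (j.val + 1)) k).re -
            f (-(fourierCoeffZMod (fun j : ZMod (n + 1) => c (j.val + 1)) k).re)) / 2 := by
    rintro _ rfl hA
    exact sum_eigenvalues_comp (x := fun j : ZMod (n + 1) => c (j.val + 1)) hA f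
  have h1 := key (revCirculant (n + 1) c) (by
    ext i j
    simp only [revCirculant, Matrix.of_apply, ZMod.val_add]
    rfl) (revCirculant_isHermitian _ _)
  rw [esd_eq_empiricalMeasure, integral_empiricalMeasure, integral_empiricalMeasure, ZMod.card,
    Fintype.card_fin, smul_eq_mul, smul_eq_mul, ← mul_add]
  congr 1

/-- Deterministic: Lévy's continuity theorem gives weak convergence in the plane, tested on the
bounded continuous symmetrization of `f`. The self-conjugate frequencies add at most `2 * ‖f‖ / (n +
1)`. -/
theorem tendsto_esd_revCirculant {x : ℕ → ℝ}
    (h : ∀ t : ℂ, Tendsto (fun n : ℕ => empiricalCharFun t fun j : ZMod (n + 1) => x (j.val + 1))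
      atTop (𝓝 ((Real.exp (-(‖t‖ ^ 2 / 4)) : ℝ) : ℂ))) :
    Tendsto (fun n : ℕ => esd (revCirculant (n + 1) fun j => x j / Real.sqrt ((n + 1 : ℕ) : ℝ))
      (revCirculant_isHermitian _ _)) atTop (𝓝 symRayleigh) := by
  have hγ : Tendsto (fun n : ℕ => empiricalMeasure (fourierCoeffZMod
      fun j : ZMod (n + 1) => x (j.val + 1) / Real.sqrt ((n + 1 : ℕ) : ℝ))) atTop
      (𝓝 complexGaussian) := by
    refine ProbabilityMeasure.tendsto_of_tendsto_charFun fun t => ?_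
    rw [charFun_complexGaussian]
    refine (h t).congr fun n => ?_
    rw [← charFun_empiricalMeasure_fourierCoeffZMod]
  rw [ProbabilityMeasure.tendsto_iff_forall_integral_tendsto] at hγ ⊢
  intro f
  let g : BoundedContinuousFunction ℂ ℝ :=
    BoundedContinuousFunction.ofNormedAddCommGroup (fun z => (f ‖z‖ + f (-‖z‖)) / 2)
      (by fun_prop) ‖f‖ fun z => by
        rw [Real.norm_eq_abs, abs_div, abs_two, div_le_iff₀ two_pos]
        refine (abs_add_le _ _).trans ?_
        have h1 := f.norm_coe_le_norm ‖z‖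
        have h2 := f.norm_coe_le_norm (-‖z‖)
        rw [Real.norm_eq_abs] at h1 h2
        linarith
  have hg := hγ g
  have hgf : ∫ z, g z ∂(complexGaussian : Measure ℂ) = ∫ x, f x ∂(symRayleigh : Measure ℝ) :=
    integral_complexGaussian_symmetrized_norm f
  rw [hgf] at hg
  simp_rw [integral_esd_revCirculant]
  rw [← add_zero (∫ x, f x ∂(symRayleigh : Measure ℝ))]
  refine hg.add ?_
  refine squeeze_zero_norm (a := fun n : ℕ => 2 * ‖f‖ / ((n + 1 : ℕ) : ℝ)) (fun n => ?_)
    (tendsto_const_nhds.div_atTop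
      ((tendsto_natCast_atTop_atTop (R := ℝ)).comp (tendsto_add_atTop_nat 1)))
  rw [norm_mul, norm_inv, Real.norm_natCast, inv_mul_eq_div]
  gcongr
  refine (norm_sum_le_of_le _ (n := fun _ => ‖f‖) fun k _ => ?_).trans ?_
  · rw [Real.norm_eq_abs, abs_div, abs_two, div_le_iff₀ two_pos]
    refine (abs_sub _ _).trans ?_
    rw [← Real.norm_eq_abs, ← Real.norm_eq_abs, mul_two]
    exact add_le_add (f.norm_coe_le_norm _) (f.norm_coe_le_norm _)
  · rw [Finset.sum_const, nsmul_eq_mul]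
    gcongr
    exact_mod_cast card_eq_neg_le_two (N := n + 1)

theorem theorem1 {Ω : Type*} [MeasurableSpace Ω] (P : Measure Ω) [IsProbabilityMeasure P]
    (X : ℕ → Ω → ℝ)
    (hindep : iIndepFun X P)
    (hident : ∀ j, IdentDistrib (X j) (X 0) P P)
    (hmean : ∀ j, ∫ ω, X j ω ∂P = 0)
    (hvar : ∀ j, variance (X j) P = 1) :
    (∀ᵐ ω ∂P, Tendsto
      (fun n : ℕ =>
        esd (revCirculant (n + 1) fun j => X j ω / Real.sqrt ((n + 1 : ℕ) : ℝ))
          (revCirculant_isHermitian _ _))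
      atTop (𝓝 symRayleigh)) ∧
    ∀ p : ℕ, ∫ x : ℝ, x ^ (2 * p) ∂(symRayleigh : Measure ℝ) = (p.factorial : ℝ) := by
  refine ⟨?_, integral_symRayleigh_pow⟩
  have h1 : P[X 0 ^ 2] = 1 := by
    rw [← hvar 0, variance_of_integral_eq_zero (hident 0).aemeasurable_fst (hmean 0)]
    rfl
  filter_upwards [ae_forall_tendsto_empiricalCharFun hindep hident (hmean 0) h1] with ω hω
  exact tendsto_esd_revCirculant hω
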